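/- **Setting.** A real sequence $\{d_{n+1}\}_{n\ge1}$ is a *positive chain sequence* if it has a *parameter sequence*, i.e. a sequence $\{g_n\}_{n\ge1}$ with $0\le g_1<1$, $0<g_n<1$ for $n\ge2$, and $d_{n+1}=(1-g_n)g_{n+1}$ for $n\ge1$; it is *non-SP* (non single parameter) if it has more than one parameter sequence. A sequence $\{q_{n+1}\}_{n\ge1}$ with $0<q_{n+1}\le1$ is a *scaling sequence* for $\{d_{n+1}\}$ if $\{d_{n+1}/q_{n+1}\}_{n\ge1}$ is also a positive chain sequence. Let $\mu$ be a nontrivial (infinitely supported) Borel probability measure on the unit circle $\mathbb T$, with monic orthogonal polynomials $\Phi_n$, reversed polynomials $\Phi_n^*(z)=z^n\overline{\Phi_n(1/\bar z)}$ and Verblunsky coefficients $\alpha_n=-\overline{\Phi_{n+1}(0)}$, and put $\tau_n=\Phi_n(1)/\Phi_n^*(1)$, $n\ge0$. We say that $\mu$ has the $(c_n,d_n)$-parametrization $\{c_n\}_{n\ge1}$, $\{d_{n+1}\}_{n\ge1}$ if for all $n\ge1$ $$c_n=\frac{-\operatorname{Im}(\tau_{n-1}\alpha_{n-1})}{1-\operatorname{Re}(\tau_{n-1}\alpha_{n-1})},\qquad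 d_{n+1}=(1-g_n)g_{n+1},\qquad\text{where}\quad g_n=\frac12\,\frac{|1-\tau_{n-1}\alpha_{n-1}|^2}{1-\operatorname{Re}(\tau_{n-1}\alpha_{n-1})}.$$ With $a=\mu(\{1\})\in[0,1)$, the corresponding family of measures is $$\mu(t;\cdot)=\frac{1-t}{1-a}\,\mu+\frac{t-a}{1-a}\,\delta_1,\qquad 0\le t<1,$$ so that $\mu(t;\{1\})=t$; in particular $\mu(0;\cdot)$ is the normalized restriction of $\mu$ to $\mathbb T\setminus\{1\}$. For $a,b\in\mathbb R$ and $0\le q<1$ let $u^{(-)}(a,b,q)<u^{(+)}(a,b,q)$ be the roots of $(1-q)u^2-(a+b)u+ab-q=0$ (in the theorem $q>0$, so they are real and distinct); for $q=1$ put $u^{(+)}(a,b,1)=+\infty$ if $a+b\ge0$, $u^{(-)}(a,b,1)=-\infty$ if $a+b\le0$, and in the remaining cases let $u^{(\pm)}(a,b,1)$ be the single root $(ab-1)/(a+b)$. The expression $u/\sqrt{1+u^2}$ is read as $\pm1$ at $u=\pm\infty$. **Theorem.** Let $\{c_n\}_{n\ge1}$ be a real sequence, $\{d_{n+1}\}_{n\ge1}$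 a non-SP positive chain sequence, and $\{q_{n+1}\}_{n\ge1}$ a scaling sequence for $\{d_{n+1}\}$. Let $\mu$ be any nontrivial Borel probability measure on $\mathbb T$ with $(c_n,d_n)$-parametrization $\{c_n\}$, $\{d_{n+1}\}$, and let $\mu(t;\cdot)$, $0\le t<1$, be the corresponding family. Put $u_{n+1}^{(\pm)}=u^{(\pm)}(c_n,c_{n+1},q_{n+1})$ for $n\ge1$, and for $N\ge2$ $$A_N=\min_{2\le n\le N}\frac{u_n^{(-)}}{\sqrt{1+(u_n^{(-)})^2}},\qquad B_N=\max_{2\le n\le N}\frac{u_n^{(+)}}{\sqrt{1+(u_n^{(+)})^2}}.$$ Then the limits $$\vartheta_1=2\lim_{N\to\infty}\arccos(B_N),\qquad \vartheta_2=2\lim_{N\to\infty}\arccos(A_N)$$ exist, $0\le\vartheta_1<\vartheta_2\le2\pi$, and $$\operatorname{supp}\mu(0;\cdot)\subseteq\{e^{i\theta}:\ \vartheta_1\le\theta\le\vartheta_2\}.$$ -/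

import Mathlib

open MeasureTheory Filter Topology Polynomial

noncomputable section

namespace UnitCircle

/-! ### Chain sequences

Sequences keep their customary indices: a chain sequence is `d 2, d 3, …`, a parameter sequence is
`g 1, g 2, …`, a scaling sequence is `q 2, q 3, …`. The values at smaller indices play no role. -/

/-- `g 1, g 2, …` is a parameter sequence of `d 2, d 3, …`. -/
def IsParameterSequence (d g : ℕ → ℝ) : Prop :=
  0 ≤ g 1 ∧ g 1 < 1 ∧ (∀ n, 2 ≤ n → 0 < g n ∧ g n < 1) ∧
    ∀ n, 1 ≤ n → d (n + 1) = (1 - g n) * g (n + 1)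

/-- `d 2, d 3, …` is a positive chain sequence. -/
def IsPositiveChainSequence (d : ℕ → ℝ) : Prop :=
  ∃ g, IsParameterSequence d g

/-- A positive chain sequence that is not single parameter: it has at least two
parameter sequences. -/
def IsNonSPChainSequence (d : ℕ → ℝ) : Prop :=
  IsPositiveChainSequence d ∧
    ∃ g g', IsParameterSequence d g ∧ IsParameterSequence d g' ∧ ∃ n, 1 ≤ n ∧ g n ≠ g' n

/-- `q 2, q 3, …` is a scaling sequence for `d 2, d 3, …`. -/
def IsScalingSequence (d q : ℕ → ℝ) : Prop :=
  (∀ n, 1 ≤ n → 0 < q (n + 1) ∧ q (n + 1) ≤ 1) ∧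
    IsPositiveChainSequence (fun n => d n / q n)

/-! ### Orthogonal polynomials on the unit circle -/

instance instMeasurableSpaceCircle : MeasurableSpace Circle := borel Circle

instance instBorelSpaceCircle : BorelSpace Circle := ⟨rfl⟩

/-- A nontrivial probability measure on the unit circle: its support is infinite. -/
def IsNontrivialProbability (μ : Measure Circle) : Prop :=
  IsProbabilityMeasure μ ∧ μ.support.Infinite

/-- The monic orthogonal polynomials `Φ_n` of `μ`, obtained from `1, z, z², …` by the
Gram–Schmidt process in `L²(μ)`. -/
def monicOPUC (μ : Measure Circle) (n : ℕ) : ℂ[X] :=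
  X ^ n - ∑ j : Fin n,
    C ((∫ z : Circle, (z : ℂ) ^ n * starRingEnd ℂ ((monicOPUC μ j).eval (z : ℂ)) ∂μ) /
        (∫ z : Circle, (monicOPUC μ j).eval (z : ℂ) *
          starRingEnd ℂ ((monicOPUC μ j).eval (z : ℂ)) ∂μ)) * monicOPUC μ j
termination_by n
decreasing_by all_goals exact j.isLt

/-- The reversed polynomial `Φ_n^*(z) = z ^ n * conj (Φ_n (1 / conj z))`. -/
def reversedOPUC (μ : Measure Circle) (n : ℕ) : ℂ[X] :=
  ((monicOPUC μ n).map (starRingEnd ℂ)).reflect n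

/-- The Verblunsky coefficients `α_n = - conj (Φ_{n+1}(0))`, `n ≥ 0`. -/
def verblunsky (μ : Measure Circle) (n : ℕ) : ℂ :=
  -starRingEnd ℂ ((monicOPUC μ (n + 1)).eval 0)

/-- `τ_n = Φ_n(1) / Φ_n^*(1)`, `n ≥ 0`. -/
def tau (μ : Measure Circle) (n : ℕ) : ℂ :=
  (monicOPUC μ n).eval 1 / (reversedOPUC μ n).eval 1

/-- `c_n = - Im (τ_{n-1} α_{n-1}) / (1 - Re (τ_{n-1} α_{n-1}))`, meant for `n ≥ 1`. -/
def cCoeff (μ : Measure Circle) (n : ℕ) : ℝ :=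
  -(tau μ (n - 1) * verblunsky μ (n - 1)).im / (1 - (tau μ (n - 1) * verblunsky μ (n - 1)).re)

/-- `g_n = |1 - τ_{n-1} α_{n-1}|² / (2 (1 - Re (τ_{n-1} α_{n-1})))`, meant for `n ≥ 1`. -/
def gCoeff (μ : Measure Circle) (n : ℕ) : ℝ :=
  1 / 2 * (‖1 - tau μ (n - 1) * verblunsky μ (n - 1)‖ ^ 2 /
    (1 - (tau μ (n - 1) * verblunsky μ (n - 1)).re))

/-- `c 1, c 2, …` and `d 2, d 3, …` are the coefficients attached to the nontrivial probability
measure `μ`, through its Verblunsky coefficients. -/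
def HasCDParametrization (μ : Measure Circle) (c d : ℕ → ℝ) : Prop :=
  IsNontrivialProbability μ ∧ (∀ n, 1 ≤ n → c n = cCoeff μ n) ∧
    ∀ n, 1 ≤ n → d (n + 1) = (1 - gCoeff μ n) * gCoeff μ (n + 1)

/-- The family `μ(t; ·) = (1 - t) / (1 - a) μ + (t - a) / (1 - a) δ_1`, `0 ≤ t < 1`, where
`a = μ {1} < 1`. As `t - a` may be negative, it is written with the part of `μ` off the point `1`;
`massFamily_real` below gives the formula above. -/
def massFamily (μ : Measure Circle) (t : ℝ) : Measure Circle :=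
  ENNReal.ofReal ((1 - t) / (1 - μ.real {1})) • μ.restrict {1}ᶜ +
    ENNReal.ofReal t • Measure.dirac 1

theorem massFamily_real (μ : Measure Circle) [IsProbabilityMeasure μ] (ha : μ.real {1} < 1)
    (t : ℝ) (ht0 : 0 ≤ t) (ht1 : t < 1) (s : Set Circle) (hs : MeasurableSet s) :
    (massFamily μ t).real s =
      (1 - t) / (1 - μ.real {1}) * μ.real s +
        (t - μ.real {1}) / (1 - μ.real {1}) * (Measure.dirac (1 : Circle)).real s := by
  have h1 : (0 : ℝ) < 1 - μ.real {1} := by linarith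
  have h2 : (0 : ℝ) ≤ (1 - t) / (1 - μ.real {1}) := div_nonneg (by linarith) h1.le
  have f1 : (ENNReal.ofReal ((1 - t) / (1 - μ.real {1})) • μ.restrict {1}ᶜ) s ≠ ⊤ := by
    rw [Measure.smul_apply, smul_eq_mul]
    exact ENNReal.mul_ne_top ENNReal.ofReal_ne_top (measure_ne_top _ _)
  have f2 : (ENNReal.ofReal t • Measure.dirac (1 : Circle)) s ≠ ⊤ := by
    rw [Measure.smul_apply, smul_eq_mul]
    exact ENNReal.mul_ne_top ENNReal.ofReal_ne_top (measure_ne_top _ _)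
  rw [massFamily, measureReal_add_apply f1 f2, measureReal_ennreal_smul_apply,
    measureReal_ennreal_smul_apply, ENNReal.toReal_ofReal h2, ENNReal.toReal_ofReal ht0,
    measureReal_restrict_apply hs]
  have hd : (Measure.dirac (1 : Circle)).real s = s.indicator (fun _ => (1 : ℝ)) 1 := by
    by_cases h : (1 : Circle) ∈ s <;> simp [Measure.real, Measure.dirac_apply' _ hs, h]
  rw [hd]
  have hsplit := measureReal_inter_add_sdiff (μ := μ) (s := s) (measurableSet_singleton (1 : Circle))
  rw [Set.sdiff_eq] at hsplit
  by_cases h : (1 : Circle) ∈ s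
  · rw [Set.inter_eq_right.mpr (Set.singleton_subset_iff.mpr h)] at hsplit
    rw [← hsplit]
    simp only [h, Set.indicator_of_mem]
    field_simp
    ring
  · rw [Set.inter_singleton_eq_empty.mpr h] at hsplit
    simp only [measureReal_empty, zero_add] at hsplit
    simp [h, hsplit]

/-- The closed arc `{e^{iθ} : θ₁ ≤ θ ≤ θ₂}`. -/
def closedArc (θ₁ θ₂ : ℝ) : Set Circle :=
  Circle.exp '' Set.Icc θ₁ θ₂

/-! ### The bounds `A_N` and `B_N` -/

/-- The smaller root `u^{(-)}(a, b, q)` of `(1 - q) u² - (a + b) u + a b - q`, `0 ≤ q ≤ 1`.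
If `q = 1`, it is `-∞` when `a + b ≤ 0` and the only root when `a + b > 0`. -/
def uMinus (a b q : ℝ) : EReal :=
  if q = 1 then
    if a + b ≤ 0 then ⊥ else (((a * b - 1) / (a + b) : ℝ) : EReal)
  else
    (((a + b - √((a + b) ^ 2 - 4 * (1 - q) * (a * b - q))) / (2 * (1 - q)) : ℝ) : EReal)

/-- The larger root `u^{(+)}(a, b, q)` of `(1 - q) u² - (a + b) u + a b - q`, `0 ≤ q ≤ 1`.
If `q = 1`, it is `+∞` when `a + b ≥ 0` and the only root when `a + b < 0`. -/
def uPlus (a b q : ℝ) : EReal :=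
  if q = 1 then
    if 0 ≤ a + b then ⊤ else (((a * b - 1) / (a + b) : ℝ) : EReal)
  else
    (((a + b + √((a + b) ^ 2 - 4 * (1 - q) * (a * b - q))) / (2 * (1 - q)) : ℝ) : EReal)

/-- `u / √(1 + u²)`, with the limit values `1` at `+∞` and `-1` at `-∞`. -/
def toCos (u : EReal) : ℝ :=
  if u = ⊤ then 1 else if u = ⊥ then -1 else u.toReal / √(1 + u.toReal ^ 2)

/-- `A_N = min_{2 ≤ n ≤ N} u_n^{(-)} / √(1 + (u_n^{(-)})²)` for `N ≥ 2`, where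
`u_n^{(-)} = u^{(-)}(c_{n-1}, c_n, q_n)`. -/
def lowerBound (c q : ℕ → ℝ) (N : ℕ) : ℝ :=
  if h : 2 ≤ N then
    (Finset.Icc 2 N).inf' (Finset.nonempty_Icc.mpr h)
      (fun n => toCos (uMinus (c (n - 1)) (c n) (q n)))
  else 0

/-- `B_N = max_{2 ≤ n ≤ N} u_n^{(+)} / √(1 + (u_n^{(+)})²)` for `N ≥ 2`, where
`u_n^{(+)} = u^{(+)}(c_{n-1}, c_n, q_n)`. -/
def upperBound (c q : ℕ → ℝ) (N : ℕ) : ℝ :=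
  if h : 2 ≤ N then
    (Finset.Icc 2 N).sup' (Finset.nonempty_Icc.mpr h)
      (fun n => toCos (uPlus (c (n - 1)) (c n) (q n)))
  else 0

end UnitCircle

end

namespace UnitCircle

open ComplexConjugate

/-! ### The inner product on polynomials -/

/-! For `ζ = e^{iθ/2}` the weight `Re ζ - Re (conj ζ z)` equals `2 sin (t/2) sin ((t-θ)/2)` at `z =
e^{it}`. It vanishes at `1`, is negative for `0 < t < θ` and positive for `θ < t < 2π`. If the
weight times `|p|²` has nonnegative `μ`-integral for every polynomial `p`, then by density `μ` does
not charge the first arc. With the opposite sign it does not charge the second. So everything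
reduces to the positivity of a quadratic form.

This form is tridiagonal in a suitable basis. Let `R_n = (z Φ_n - τ_n Φ_n^*) / (z - 1)`, `β_n = τ_n
α_n` and `N_n = ‖Φ_n‖²`. In the basis `z^{-⌊n/2⌋} R_n`, `n ≥ 0`, of the Laurent polynomials, the
diagonal entries are `N_n Re (ζ (1 - β_n)) = N_n (1 - Re β_n) (x - c_{n+1} s)` with `x = cos (θ/2)`,
`s = sin (θ/2)`, and the off-diagonal entries have modulus `N_{n+1} |1 - β_{n+1}| / 2`. The squared
off-diagonal entry divided by the product of its two diagonal neighbours is exactly `d_{n+2} / ((x -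
c_{n+1} s) (x - c_{n+2} s))`.

If the diagonal is positive and these ratios are bounded by the chain sequence `d / q`, completing
squares with a parameter sequence of `d / q` gives positivity (`le_weightForm_self`). The bound asks
that `q_{n+1} ≤ (x - c_n s) (x - c_{n+1} s)`. For `v = cot (θ/2)` this says that the quadratic
defining `u^{(±)}` is nonnegative at `v`, and positivity of the diagonal selects `v ≥ u^{(+)}`
(`le_mul_of_toCos_uPlus_le`). The other side of the spectrum follows by changing the signs of the
form and of `c`. -/

theorem continuous_polynomial_eval_circle (p : ℂ[X]) :
    Continuous fun z : Circle => p.eval (z : ℂ) :=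
  p.continuous.comp continuous_subtype_val

theorem integrable_of_continuous_circle {μ : Measure Circle} [IsProbabilityMeasure μ]
    {f : Circle → ℂ} (hf : Continuous f) : Integrable f μ :=
  hf.integrable_of_hasCompactSupport (HasCompactSupport.of_compactSpace f)

theorem integrable_conj_eval_mul_eval (μ : Measure Circle) [IsProbabilityMeasure μ] (p q : ℂ[X]) :
    Integrable (fun z : Circle => conj (p.eval (z : ℂ)) * q.eval (z : ℂ)) μ :=
  integrable_of_continuous_circle
    ((Complex.continuous_conj.comp (continuous_polynomial_eval_circle p)).mul
      (continuous_polynomial_eval_circle q))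

/-- The inner product of `L²(μ)` on polynomials, conjugate-linear in the first argument. -/
noncomputable def polyForm (μ : Measure Circle) [IsProbabilityMeasure μ] :
    ℂ[X] →ₗ⋆[ℂ] ℂ[X] →ₗ[ℂ] ℂ :=
  LinearMap.mk₂'ₛₗ (starRingEnd ℂ) (RingHom.id ℂ)
    (fun p q => ∫ z : Circle, conj (p.eval (z : ℂ)) * q.eval (z : ℂ) ∂μ)
    (fun p p' q => by
      simp only [eval_add, map_add, add_mul]
      exact integral_add (integrable_conj_eval_mul_eval μ p q)
        (integrable_conj_eval_mul_eval μ p' q))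
    (fun c p q => by
      simp only [eval_smul, smul_eq_mul, map_mul, mul_assoc]
      exact integral_const_mul _ _)
    (fun p q q' => by
      simp only [eval_add, mul_add]
      exact integral_add (integrable_conj_eval_mul_eval μ p q)
        (integrable_conj_eval_mul_eval μ p q'))
    (fun c p q => by
      simp only [eval_smul, smul_eq_mul, mul_left_comm _ c, RingHom.id_apply]
      exact integral_const_mul _ _)

section Form

variable (μ : Measure Circle) [IsProbabilityMeasure μ]

theorem polyForm_apply (p q : ℂ[X]) :
    polyForm μ p q = ∫ z : Circle, conj (p.eval (z : ℂ)) * q.eval (z : ℂ) ∂μ := rfl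

theorem polyForm_C_mul_left (a : ℂ) (p q : ℂ[X]) :
    polyForm μ (C a * p) q = conj a * polyForm μ p q := by
  rw [← smul_eq_C_mul, map_smulₛₗ, LinearMap.smul_apply, smul_eq_mul]

theorem polyForm_C_mul_right (a : ℂ) (p q : ℂ[X]) :
    polyForm μ p (C a * q) = a * polyForm μ p q := by
  rw [← smul_eq_C_mul, map_smul, smul_eq_mul]

theorem conj_polyForm (p q : ℂ[X]) : conj (polyForm μ p q) = polyForm μ q p := by
  rw [polyForm_apply, polyForm_apply, ← integral_conj]
  congr 1
  ext z
  simp [mul_comm]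

theorem conj_coe_mul_coe (z : Circle) : conj (z : ℂ) * (z : ℂ) = 1 := by
  rw [mul_comm, Complex.mul_conj, Circle.normSq_coe, Complex.ofReal_one]

theorem polyForm_X_mul_X_mul (p q : ℂ[X]) : polyForm μ (X * p) (X * q) = polyForm μ p q := by
  rw [polyForm_apply, polyForm_apply]
  congr 1
  ext z
  simp only [eval_mul, eval_X, map_mul]
  linear_combination conj (p.eval (z : ℂ)) * q.eval (z : ℂ) * conj_coe_mul_coe z

theorem polyForm_self (p : ℂ[X]) :
    polyForm μ p p = ((∫ z : Circle, ‖p.eval (z : ℂ)‖ ^ 2 ∂μ : ℝ) : ℂ) := by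
  rw [polyForm_apply]
  refine Eq.trans ?_ integral_complex_ofReal
  congr 1
  ext z
  rw [Complex.conj_mul']
  norm_cast

theorem polyForm_self_re_nonneg (p : ℂ[X]) : 0 ≤ (polyForm μ p p).re := by
  rw [polyForm_self, Complex.ofReal_re]
  exact integral_nonneg fun z => by positivity

theorem polyForm_self_eq_re (p : ℂ[X]) : polyForm μ p p = ((polyForm μ p p).re : ℂ) := by
  rw [polyForm_self, Complex.ofReal_re]

variable {μ}

/-- A polynomial of norm zero vanishes on the whole support by continuity, and a nonzero polynomial
has only finitely many zeros. -/
theorem eq_zero_of_polyForm_self (hμ : μ.support.Infinite) {p : ℂ[X]}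
    (hp : polyForm μ p p = 0) : p = 0 := by
  by_contra hne
  rw [polyForm_self, Complex.ofReal_eq_zero] at hp
  have hc : Continuous fun z : Circle => ‖p.eval (z : ℂ)‖ ^ 2 :=
    (continuous_polynomial_eval_circle p).norm.pow 2
  rw [integral_eq_zero_iff_of_nonneg (fun z => by positivity)
    (hc.integrable_of_hasCompactSupport (HasCompactSupport.of_compactSpace _))] at hp
  have hcl : IsClosed {z : Circle | p.eval (z : ℂ) = 0} :=
    isClosed_eq (continuous_polynomial_eval_circle p) continuous_const
  have hsub : μ.support ⊆ {z : Circle | p.eval (z : ℂ) = 0} := by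
    refine Measure.support_subset_of_isClosed hcl ?_
    filter_upwards [hp] with z hz
    simpa using hz
  refine hμ (Set.Finite.subset ?_ hsub)
  have hfin : (p.roots.toFinset : Set ℂ).Finite := Finset.finite_toSet _
  refine (hfin.preimage (f := ((↑) : Circle → ℂ)) Circle.coe_injective.injOn).subset fun z hz => ?_
  have hz' : p.eval (z : ℂ) = 0 := hz
  simpa [hne] using hz'

/-- A polynomial orthogonal to `f 0, …, f (n - 1)`, where `f j` is monic of degree `j`, is
orthogonal to all polynomials of degree less than `n`. -/
theorem polyForm_eq_zero_of_degree_lt {f : ℕ → ℂ[X]} {q : ℂ[X]} {n : ℕ}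
    (hf : ∀ j < n, (f j).Monic ∧ (f j).natDegree = j) (hq : ∀ j < n, polyForm μ (f j) q = 0) :
    ∀ p : ℂ[X], p.degree < n → polyForm μ p q = 0 := by
  induction n with
  | zero =>
    intro p hp
    have : p = 0 := by simpa [degree_eq_bot] using hp
    simp [this]
  | succ k ih =>
    intro p hp
    have hlt : (p - C (p.coeff k) * f k).degree < k := by
      have hfk := hf k (Nat.lt_succ_self k)
      rw [degree_lt_iff_coeff_zero]
      intro m hm
      rcases hm.eq_or_lt with rfl | hm
      · have : (f k).coeff k = 1 := by
          have := hfk.1.coeff_natDegree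
          rwa [hfk.2] at this
        simp [this]
      · have h1 : p.coeff m = 0 := (degree_lt_iff_coeff_zero _ _).1 hp m hm
        have h2 : (f k).coeff m = 0 := coeff_eq_zero_of_natDegree_lt (by omega)
        simp [h1, h2]
    have h0 := ih (fun j hj => hf j (by omega)) (fun j hj => hq j (by omega)) _ hlt
    rw [map_sub, LinearMap.sub_apply, polyForm_C_mul_left, hq k (Nat.lt_succ_self k), mul_zero,
      sub_zero] at h0
    exact h0

end Form

/-! ### Orthogonal polynomials and the Szegő recurrence -/

section OPUC

variable {μ : Measure Circle} [IsProbabilityMeasure μ]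

theorem monicOPUC_eq (μ : Measure Circle) [IsProbabilityMeasure μ] (n : ℕ) :
    monicOPUC μ n = X ^ n - ∑ j : Fin n,
      C (polyForm μ (monicOPUC μ j) (X ^ n) / polyForm μ (monicOPUC μ j) (monicOPUC μ j)) *
        monicOPUC μ j := by
  rw [monicOPUC]
  simp only [polyForm_apply, eval_pow, eval_X, mul_comm]

theorem monicOPUC_monic_natDegree (n : ℕ) :
    (monicOPUC μ n).Monic ∧ (monicOPUC μ n).natDegree = n := by
  induction n using Nat.strong_induction_on with
  | _ n ih =>
    have hlt : (∑ j : Fin n,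
        C (polyForm μ (monicOPUC μ j) (X ^ n) / polyForm μ (monicOPUC μ j) (monicOPUC μ j)) *
          monicOPUC μ j).degree < n := by
      rw [← mem_degreeLT]
      refine Submodule.sum_mem _ fun j _ => ?_
      rw [← smul_eq_C_mul]
      refine Submodule.smul_mem _ _ (mem_degreeLT.2 ?_)
      rw [degree_eq_natDegree (ih j j.2).1.ne_zero, (ih j j.2).2]
      exact_mod_cast j.2
    rw [monicOPUC_eq]
    refine ⟨(monic_X_pow n).sub_of_left (by rwa [degree_X_pow]), ?_⟩
    rw [natDegree_eq_of_degree_eq (degree_sub_eq_left_of_degree_lt (by rwa [degree_X_pow])),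
      natDegree_X_pow]

theorem monicOPUC_monic (n : ℕ) : (monicOPUC μ n).Monic := (monicOPUC_monic_natDegree n).1

theorem natDegree_monicOPUC (n : ℕ) : (monicOPUC μ n).natDegree = n :=
  (monicOPUC_monic_natDegree n).2

theorem coeff_monicOPUC_self (n : ℕ) : (monicOPUC μ n).coeff n = 1 := by
  have := (monicOPUC_monic (μ := μ) n).coeff_natDegree
  rwa [natDegree_monicOPUC] at this

theorem polyForm_monicOPUC_self_ne_zero (hμ : μ.support.Infinite) (n : ℕ) :
    polyForm μ (monicOPUC μ n) (monicOPUC μ n) ≠ 0 := fun h =>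
  (monicOPUC_monic n).ne_zero (eq_zero_of_polyForm_self hμ h)

theorem polyForm_monicOPUC_of_lt (hμ : μ.support.Infinite) (n : ℕ) :
    ∀ j < n, polyForm μ (monicOPUC μ j) (monicOPUC μ n) = 0 := by
  induction n using Nat.strong_induction_on with
  | _ n ih =>
    intro j hj
    rw [monicOPUC_eq μ n, map_sub, map_sum, Finset.sum_eq_single (⟨j, hj⟩ : Fin n)]
    · rw [polyForm_C_mul_right, div_mul_cancel₀ _ (polyForm_monicOPUC_self_ne_zero hμ j), sub_self]
    · intro i _ hij
      rw [polyForm_C_mul_right]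
      have hne : (i : ℕ) ≠ j := fun h => hij (Fin.ext h)
      rcases lt_or_gt_of_ne hne with h | h
      · rw [← conj_polyForm μ _ (monicOPUC μ j), ih j hj i h, map_zero, mul_zero]
      · rw [ih i i.2 j h, mul_zero]
    · simp

theorem polyForm_monicOPUC_eq_zero (hμ : μ.support.Infinite) {n : ℕ} {p : ℂ[X]}
    (hp : p.degree < n) : polyForm μ p (monicOPUC μ n) = 0 :=
  polyForm_eq_zero_of_degree_lt (f := monicOPUC μ) (fun _ _ => monicOPUC_monic_natDegree _)
    (polyForm_monicOPUC_of_lt hμ n) p hp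

theorem eval_conj_map_reflect (n : ℕ) (p : ℂ[X]) (hp : p.natDegree ≤ n) (z : Circle) :
    ((p.map (starRingEnd ℂ)).reflect n).eval (z : ℂ) = (z : ℂ) ^ n * conj (p.eval (z : ℂ)) := by
  have hz : conj (z : ℂ) * z = 1 := conj_coe_mul_coe z
  -- On the circle `z` is the inverse of `conj z`, so evaluating the reflection at `z` means
  -- evaluating the conjugated polynomial at `conj z`.
  let _ : Invertible (conj (z : ℂ)) := ⟨z, by rw [mul_comm]; exact hz, hz⟩
  have h := eval₂_reflect_mul_pow (RingHom.id ℂ) (conj (z : ℂ)) n (p.map (starRingEnd ℂ))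
    (natDegree_map_le.trans hp)
  have hinv : ⅟(conj (z : ℂ)) = (z : ℂ) := rfl
  rw [hinv] at h
  change ((p.map (starRingEnd ℂ)).reflect n).eval (z : ℂ) * _ =
    (p.map (starRingEnd ℂ)).eval (conj (z : ℂ)) at h
  have hc := hom_eval₂ p (RingHom.id ℂ) (starRingEnd ℂ) (z : ℂ)
  rw [RingHom.comp_id] at hc
  rw [eval_map, ← hc] at h
  change _ = conj (p.eval (z : ℂ)) at h
  rw [← h]
  have hz' : (z : ℂ) ^ n * conj (z : ℂ) ^ n = 1 := by
    rw [← mul_pow, mul_comm, hz, one_pow]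
  linear_combination -((p.map (starRingEnd ℂ)).reflect n).eval (z : ℂ) * hz'

theorem eval_reversedOPUC (n : ℕ) (z : Circle) :
    (reversedOPUC μ n).eval (z : ℂ) = (z : ℂ) ^ n * conj ((monicOPUC μ n).eval (z : ℂ)) :=
  eval_conj_map_reflect n _ (natDegree_monicOPUC n).le z

theorem natDegree_reversedOPUC_le (n : ℕ) : (reversedOPUC μ n).natDegree ≤ n := by
  rw [natDegree_le_iff_coeff_eq_zero]
  intro N hN
  rw [reversedOPUC, coeff_reflect, revAt_eq_self_of_lt hN, coeff_map,
    coeff_eq_zero_of_natDegree_lt (by rwa [natDegree_monicOPUC]), map_zero]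

theorem coeff_zero_reversedOPUC (n : ℕ) : (reversedOPUC μ n).coeff 0 = 1 := by
  rw [reversedOPUC, coeff_reflect, revAt_le (Nat.zero_le n), coeff_map, Nat.sub_zero,
    coeff_monicOPUC_self, map_one]

theorem polyForm_reversedOPUC_left (n : ℕ) (p : ℂ[X]) (hp : p.natDegree ≤ n) :
    polyForm μ p (reversedOPUC μ n) =
      polyForm μ (monicOPUC μ n) ((p.map (starRingEnd ℂ)).reflect n) := by
  rw [polyForm_apply, polyForm_apply]
  congr 1
  ext z
  rw [eval_reversedOPUC, eval_conj_map_reflect n p hp]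
  ring

theorem polyForm_reversedOPUC_self (n : ℕ) :
    polyForm μ (reversedOPUC μ n) (reversedOPUC μ n) =
      polyForm μ (monicOPUC μ n) (monicOPUC μ n) := by
  rw [polyForm_apply, polyForm_apply]
  congr 1
  ext z
  rw [eval_reversedOPUC, map_mul, map_pow, Complex.conj_conj]
  have : conj (z : ℂ) ^ n * (z : ℂ) ^ n = 1 := by rw [← mul_pow, conj_coe_mul_coe, one_pow]
  linear_combination (conj (eval (z : ℂ) (monicOPUC μ n)) * eval (z : ℂ) (monicOPUC μ n)) * this

/-- Reversal in degree `n` exchanges `Φ_n^*` with `Φ_n`, and turns a vanishing constant term into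
degree less than `n`. -/
theorem polyForm_X_mul_reversedOPUC (hμ : μ.support.Infinite) {n : ℕ} {p : ℂ[X]}
    (hp : (X * p).natDegree ≤ n) : polyForm μ (X * p) (reversedOPUC μ n) = 0 := by
  rw [polyForm_reversedOPUC_left n _ hp, ← conj_polyForm, polyForm_monicOPUC_eq_zero hμ, map_zero]
  rw [degree_lt_iff_coeff_zero]
  intro m hm
  rw [coeff_reflect, coeff_map]
  rcases hm.eq_or_lt with rfl | hm
  · simp [revAt_le]
  · rw [revAt_eq_self_of_lt hm, coeff_eq_zero_of_natDegree_lt (by omega), map_zero]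

theorem polyForm_reversedOPUC (hμ : μ.support.Infinite) {n : ℕ} {p : ℂ[X]}
    (hp : p.natDegree ≤ n) : polyForm μ p (reversedOPUC μ n) =
      conj (p.coeff 0) * polyForm μ (monicOPUC μ n) (monicOPUC μ n) := by
  have key : ∀ q : ℂ[X], q.natDegree ≤ n → q.coeff 0 = 0 →
      polyForm μ q (reversedOPUC μ n) = 0 := by
    intro q hq h0
    obtain ⟨r, rfl⟩ := X_dvd_iff.2 h0
    exact polyForm_X_mul_reversedOPUC hμ hq
  have h := key (p - C (p.coeff 0) * reversedOPUC μ n)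
    ((natDegree_sub_le _ _).trans (max_le hp
      ((natDegree_C_mul_le _ _).trans (natDegree_reversedOPUC_le n))))
    (by simp [coeff_zero_reversedOPUC])
  rw [map_sub, LinearMap.sub_apply, polyForm_C_mul_left, polyForm_reversedOPUC_self,
    sub_eq_zero] at h
  exact h

theorem polyForm_X_mul_monicOPUC (hμ : μ.support.Infinite) {n : ℕ} {p : ℂ[X]}
    (hp : p.natDegree ≤ n) (h0 : p.coeff 0 = 0) : polyForm μ p (X * monicOPUC μ n) = 0 := by
  obtain ⟨r, rfl⟩ := X_dvd_iff.2 h0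
  rw [polyForm_X_mul_X_mul]
  rcases eq_or_ne r 0 with rfl | hr
  · simp
  refine polyForm_monicOPUC_eq_zero hμ ?_
  rw [natDegree_X_mul hr] at hp
  rw [degree_eq_natDegree hr]
  exact_mod_cast hp

/-- Szegő recurrence. The difference `G` of the two sides has degree at most `n` because the leading
terms cancel, and no constant term by the choice of `α_n`. Such a polynomial is orthogonal to
`Φ_{n+1}`, `z Φ_n` and `Φ_n^*`, hence to itself. -/
theorem monicOPUC_succ (hμ : μ.support.Infinite) (n : ℕ) :
    monicOPUC μ (n + 1) = X * monicOPUC μ n - C (conj (verblunsky μ n)) * reversedOPUC μ n := by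
  have hα : conj (verblunsky μ n) = -(monicOPUC μ (n + 1)).coeff 0 := by
    rw [verblunsky, map_neg, Complex.conj_conj, coeff_zero_eq_eval_zero]
  set G := monicOPUC μ (n + 1) - X * monicOPUC μ n + C (conj (verblunsky μ n)) * reversedOPUC μ n
    with hG
  have hdeg : G.natDegree ≤ n := by
    rw [natDegree_le_iff_coeff_eq_zero]
    intro N hN
    have h3 : (reversedOPUC μ n).coeff N = 0 :=
      coeff_eq_zero_of_natDegree_lt ((natDegree_reversedOPUC_le n).trans_lt hN)
    obtain ⟨k, rfl⟩ : ∃ k, N = k + 1 := ⟨N - 1, by omega⟩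
    rw [hG, coeff_add, coeff_sub, coeff_X_mul, coeff_C_mul, h3, mul_zero, add_zero]
    rcases (Nat.lt_succ_iff.1 hN).eq_or_lt with rfl | hk
    · simp [coeff_monicOPUC_self]
    · rw [coeff_eq_zero_of_natDegree_lt, coeff_eq_zero_of_natDegree_lt, sub_zero] <;>
        rw [natDegree_monicOPUC] <;> omega
  have h0 : G.coeff 0 = 0 := by
    rw [hG, coeff_add, coeff_sub, coeff_C_mul, coeff_zero_reversedOPUC, hα]
    simp
  have hz : polyForm μ G G = 0 := by
    have h1 : polyForm μ G (monicOPUC μ (n + 1)) = 0 := by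
      refine polyForm_monicOPUC_eq_zero hμ (degree_le_natDegree.trans_lt ?_)
      exact_mod_cast Nat.lt_succ_of_le hdeg
    have h2 := polyForm_X_mul_monicOPUC hμ hdeg h0
    have h3 := polyForm_reversedOPUC hμ hdeg
    rw [h0, map_zero, zero_mul] at h3
    conv_lhs => rw [hG]
    rw [← hG, map_add, map_sub, h1, h2, polyForm_C_mul_right, h3]
    simp
  have := eq_zero_of_polyForm_self hμ hz
  rw [hG] at this
  linear_combination this

/-- The squared `L²(μ)` norm of `Φ_n`. -/
noncomputable def normSqOPUC (μ : Measure Circle) [IsProbabilityMeasure μ] (n : ℕ) : ℝ :=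
  (polyForm μ (monicOPUC μ n) (monicOPUC μ n)).re

theorem polyForm_monicOPUC_self (n : ℕ) :
    polyForm μ (monicOPUC μ n) (monicOPUC μ n) = (normSqOPUC μ n : ℂ) :=
  polyForm_self_eq_re μ _

theorem normSqOPUC_pos (hμ : μ.support.Infinite) (n : ℕ) : 0 < normSqOPUC μ n := by
  refine lt_of_le_of_ne (polyForm_self_re_nonneg μ _) fun h => ?_
  refine polyForm_monicOPUC_self_ne_zero hμ n ?_
  rw [polyForm_monicOPUC_self]
  exact_mod_cast h.symm

theorem polyForm_reversedOPUC_X_mul_monicOPUC (hμ : μ.support.Infinite) (n : ℕ) :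
    polyForm μ (reversedOPUC μ n) (X * monicOPUC μ n) =
      conj (verblunsky μ n) * normSqOPUC μ n := by
  have h : X * monicOPUC μ n =
      monicOPUC μ (n + 1) + C (conj (verblunsky μ n)) * reversedOPUC μ n := by
    rw [monicOPUC_succ hμ]; ring
  rw [h, map_add, polyForm_C_mul_right, polyForm_reversedOPUC_self, polyForm_monicOPUC_self,
    polyForm_monicOPUC_eq_zero hμ, zero_add]
  refine degree_le_natDegree.trans_lt ?_
  exact_mod_cast Nat.lt_succ_of_le (natDegree_reversedOPUC_le n)

theorem normSqOPUC_succ (hμ : μ.support.Infinite) (n : ℕ) :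
    normSqOPUC μ (n + 1) = (1 - ‖verblunsky μ n‖ ^ 2) * normSqOPUC μ n := by
  have h1 : polyForm μ (reversedOPUC μ n) (monicOPUC μ (n + 1)) = 0 := by
    refine polyForm_monicOPUC_eq_zero hμ (degree_le_natDegree.trans_lt ?_)
    exact_mod_cast Nat.lt_succ_of_le (natDegree_reversedOPUC_le n)
  have h2 : polyForm μ (monicOPUC μ (n + 1)) (monicOPUC μ (n + 1)) =
      polyForm μ (X * monicOPUC μ n) (monicOPUC μ (n + 1)) := by
    nth_rw 1 [monicOPUC_succ hμ n]
    rw [map_sub, LinearMap.sub_apply, polyForm_C_mul_left, h1, mul_zero, sub_zero]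
  have h3 : polyForm μ (X * monicOPUC μ n) (reversedOPUC μ n) =
      verblunsky μ n * normSqOPUC μ n := by
    rw [← conj_polyForm, polyForm_reversedOPUC_X_mul_monicOPUC hμ, map_mul, Complex.conj_conj,
      Complex.conj_ofReal]
  have h4 : (normSqOPUC μ (n + 1) : ℂ) = (((1 - ‖verblunsky μ n‖ ^ 2) * normSqOPUC μ n : ℝ) : ℂ) := by
    rw [← polyForm_monicOPUC_self, h2, monicOPUC_succ hμ, map_sub, polyForm_X_mul_X_mul,
      polyForm_monicOPUC_self, polyForm_C_mul_right, h3]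
    push_cast
    rw [← Complex.conj_mul']
    ring
  exact_mod_cast h4

theorem norm_verblunsky_lt_one (hμ : μ.support.Infinite) (n : ℕ) : ‖verblunsky μ n‖ < 1 := by
  have h1 := normSqOPUC_pos hμ (n + 1)
  rw [normSqOPUC_succ hμ] at h1
  have h2 := (mul_pos_iff_of_pos_right (normSqOPUC_pos hμ n)).1 h1
  nlinarith [norm_nonneg (verblunsky μ n)]

theorem eval_one_reversedOPUC (n : ℕ) :
    (reversedOPUC μ n).eval 1 = conj ((monicOPUC μ n).eval 1) := by
  simpa using eval_reversedOPUC (μ := μ) n 1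

/-- Since `|Φ_n(1)| = |Φ_n^*(1)|` and `|α_n| < 1`, the two terms of the recurrence cannot cancel at
`1`. This makes `τ_n` well defined and unimodular. -/
theorem eval_one_monicOPUC_ne_zero (hμ : μ.support.Infinite) (n : ℕ) :
    (monicOPUC μ n).eval 1 ≠ 0 := by
  induction n with
  | zero => rw [monicOPUC_eq]; simp
  | succ n ih =>
    intro h
    rw [monicOPUC_succ hμ, eval_sub, eval_mul, eval_mul, eval_X, eval_C, one_mul,
      eval_one_reversedOPUC, sub_eq_zero] at h
    have h' := congrArg norm h
    rw [norm_mul, Complex.norm_conj, Complex.norm_conj] at h'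
    have := norm_verblunsky_lt_one hμ n
    have := norm_pos_iff.2 ih
    nlinarith

theorem norm_tau (hμ : μ.support.Infinite) (n : ℕ) : ‖tau μ n‖ = 1 := by
  rw [tau, eval_one_reversedOPUC, norm_div, Complex.norm_conj,
    div_self (norm_ne_zero_iff.2 (eval_one_monicOPUC_ne_zero hμ n))]

theorem norm_tau_mul_verblunsky_lt_one (hμ : μ.support.Infinite) (n : ℕ) :
    ‖tau μ n * verblunsky μ n‖ < 1 := by
  rw [norm_mul, norm_tau hμ, one_mul]
  exact norm_verblunsky_lt_one hμ n

end OPUC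

/-! ### The para-orthogonal polynomials vanishing at `1` -/

section Para

variable {μ : Measure Circle} [IsProbabilityMeasure μ]

/-- The para-orthogonal polynomial `z Φ_n - τ_n Φ_n^*`, which vanishes at `1`. -/
noncomputable def paraOPUC (μ : Measure Circle) (n : ℕ) : ℂ[X] :=
  X * monicOPUC μ n - C (tau μ n) * reversedOPUC μ n

/-- The quotient of `z Φ_n - τ_n Φ_n^*` by `z - 1`. -/
noncomputable def paraQuotient (μ : Measure Circle) (n : ℕ) : ℂ[X] :=
  paraOPUC μ n /ₘ (X - C 1)

theorem X_sub_one_mul_paraQuotient (hμ : μ.support.Infinite) (n : ℕ) :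
    (X - C 1) * paraQuotient μ n = paraOPUC μ n := by
  rw [paraQuotient, mul_divByMonic_eq_iff_isRoot, IsRoot.def, paraOPUC, eval_sub, eval_mul,
    eval_mul, eval_X, eval_C, one_mul, tau, div_mul_cancel₀, sub_self]
  rw [eval_one_reversedOPUC]
  exact (_root_.map_ne_zero _).2 (eval_one_monicOPUC_ne_zero hμ n)

theorem paraOPUC_eq (hμ : μ.support.Infinite) (n : ℕ) :
    paraOPUC μ n = X * paraQuotient μ n - paraQuotient μ n := by
  rw [← X_sub_one_mul_paraQuotient hμ, map_one]
  ring

theorem coeff_paraOPUC_of_lt {n N : ℕ} (hN : n < N) :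
    (paraOPUC μ n).coeff N = if N = n + 1 then 1 else 0 := by
  have h3 : (reversedOPUC μ n).coeff N = 0 :=
    coeff_eq_zero_of_natDegree_lt ((natDegree_reversedOPUC_le n).trans_lt hN)
  obtain ⟨k, rfl⟩ : ∃ k, N = k + 1 := ⟨N - 1, by omega⟩
  rw [paraOPUC, coeff_sub, coeff_X_mul, coeff_C_mul, h3, mul_zero, sub_zero]
  split_ifs with h
  · rw [Nat.succ_injective h, coeff_monicOPUC_self]
  · refine coeff_eq_zero_of_natDegree_lt ?_
    rw [natDegree_monicOPUC]
    omega

theorem natDegree_paraQuotient (n : ℕ) : (paraQuotient μ n).natDegree = n := by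
  have h : (paraOPUC μ n).natDegree = n + 1 := by
    refine natDegree_eq_of_le_of_coeff_ne_zero ?_ ?_
    · rw [natDegree_le_iff_coeff_eq_zero]
      intro N hN
      rw [coeff_paraOPUC_of_lt (by omega), if_neg (by omega)]
    · rw [coeff_paraOPUC_of_lt (Nat.lt_succ_self n), if_pos rfl]
      exact one_ne_zero
  rw [paraQuotient, natDegree_divByMonic _ (monic_X_sub_C _), h, natDegree_X_sub_C]
  rfl

theorem coeff_paraQuotient_self (hμ : μ.support.Infinite) (n : ℕ) :
    (paraQuotient μ n).coeff n = 1 := by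
  have h := congrArg (fun p => coeff p (n + 1)) (paraOPUC_eq hμ n)
  simp only [coeff_sub, coeff_X_mul] at h
  rw [coeff_paraOPUC_of_lt (Nat.lt_succ_self n), if_pos rfl,
    coeff_eq_zero_of_natDegree_lt (n := n + 1) (by rw [natDegree_paraQuotient]; omega),
    sub_zero] at h
  exact h.symm

theorem coeff_zero_paraQuotient (hμ : μ.support.Infinite) (n : ℕ) :
    (paraQuotient μ n).coeff 0 = tau μ n := by
  have h := congrArg (fun p => coeff p 0) (paraOPUC_eq hμ n)
  simp only [paraOPUC, coeff_sub, coeff_zero_reversedOPUC, mul_coeff_zero,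
    coeff_X_zero, coeff_C_zero, zero_mul,
    zero_sub, mul_one, neg_inj] at h
  exact h.symm

theorem conj_mul_self_of_norm_eq_one {w : ℂ} (hw : ‖w‖ = 1) : conj w * w = 1 := by
  rw [Complex.conj_mul', hw]
  norm_num

/-- By the recurrence, `z Φ_n - τ_n Φ_n^*` is `Φ_{n+1}` plus a multiple of `Φ_n^*`. Only the latter
is seen, and it detects only the constant coefficient. -/
theorem polyForm_paraOPUC (hμ : μ.support.Infinite) {n : ℕ} {p : ℂ[X]} (hp : p.natDegree ≤ n) :
    polyForm μ p (paraOPUC μ n) =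
      -(conj (p.coeff 0) * tau μ n * conj (1 - tau μ n * verblunsky μ n) * normSqOPUC μ n) := by
  have h : paraOPUC μ n = monicOPUC μ (n + 1) +
      C (conj (verblunsky μ n) - tau μ n) * reversedOPUC μ n := by
    rw [monicOPUC_succ hμ, paraOPUC, map_sub]
    ring
  rw [h, map_add, polyForm_C_mul_right, polyForm_reversedOPUC hμ hp, polyForm_monicOPUC_self,
    polyForm_monicOPUC_eq_zero hμ]
  · simp only [map_sub, map_mul, map_one]
    linear_combination (-(conj (p.coeff 0) * conj (verblunsky μ n) * normSqOPUC μ n)) *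
      conj_mul_self_of_norm_eq_one (norm_tau hμ n)
  · refine degree_le_natDegree.trans_lt ?_
    exact_mod_cast Nat.lt_succ_of_le hp

/-- Companion of `polyForm_paraOPUC`: modulo a multiple of `Φ_n`, the polynomial `p` has degree less
than `n`, and the remainder contributes nothing. Together the two lemmas make the weighted form
tridiagonal. -/
theorem polyForm_X_mul_paraOPUC (hμ : μ.support.Infinite) {n : ℕ} {p : ℂ[X]}
    (hp : p.natDegree ≤ n) :
    polyForm μ (X * p) (paraOPUC μ n) =
      conj (p.coeff n) * (1 - tau μ n * verblunsky μ n) * normSqOPUC μ n := by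
  have hXr : polyForm μ (X * monicOPUC μ n) (reversedOPUC μ n) =
      verblunsky μ n * normSqOPUC μ n := by
    rw [← conj_polyForm, polyForm_reversedOPUC_X_mul_monicOPUC hμ, map_mul, Complex.conj_conj,
      Complex.conj_ofReal]
  set r := p - C (p.coeff n) * monicOPUC μ n with hr
  have hrdeg : r.degree < n := by
    rw [degree_lt_iff_coeff_zero]
    intro m hm
    rw [hr, coeff_sub, coeff_C_mul]
    rcases hm.eq_or_lt with rfl | hm
    · rw [coeff_monicOPUC_self, mul_one, sub_self]
    · rw [coeff_eq_zero_of_natDegree_lt (hp.trans_lt hm),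
        coeff_eq_zero_of_natDegree_lt (p := monicOPUC μ n) (by rwa [natDegree_monicOPUC]), mul_zero, sub_zero]
  have hr1 : polyForm μ r (monicOPUC μ n) = 0 := polyForm_monicOPUC_eq_zero hμ hrdeg
  have hr2 : polyForm μ (X * r) (reversedOPUC μ n) = 0 := by
    refine polyForm_X_mul_reversedOPUC hμ ?_
    rcases eq_or_ne r 0 with h0 | h0
    · simp [h0]
    · rw [natDegree_X_mul h0]
      exact (natDegree_lt_iff_degree_lt h0).2 hrdeg
  have hp' : X * p = C (p.coeff n) * (X * monicOPUC μ n) + X * r := by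
    rw [hr]; ring
  rw [paraOPUC, hp', map_add, LinearMap.add_apply, polyForm_C_mul_left, map_sub, map_sub,
    polyForm_C_mul_right, polyForm_C_mul_right, polyForm_X_mul_X_mul, polyForm_X_mul_X_mul,
    hXr, hr1, hr2, polyForm_monicOPUC_self]
  ring

/-! ### The form with the weight `Re ζ - Re (conj ζ z)` -/

/-- The form `∫ (Re ζ - Re (conj ζ z)) conj p q dμ` on polynomials. -/
noncomputable def weightForm (μ : Measure Circle) [IsProbabilityMeasure μ] (ζ : ℂ) (p q : ℂ[X]) :
    ℂ :=
  ζ.re * polyForm μ p q -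
    1 / 2 * (conj ζ * polyForm μ p (X * q) + ζ * polyForm μ (X * p) q)

theorem conj_weightForm (ζ : ℂ) (p q : ℂ[X]) :
    conj (weightForm μ ζ p q) = weightForm μ ζ q p := by
  simp only [weightForm, map_sub, map_mul, map_add, conj_polyForm, Complex.conj_conj,
    Complex.conj_ofReal, map_div₀, map_one, map_ofNat]
  ring

theorem weightForm_X_mul_X_mul (ζ : ℂ) (p q : ℂ[X]) :
    weightForm μ ζ (X * p) (X * q) = weightForm μ ζ p q := by
  simp only [weightForm, polyForm_X_mul_X_mul]

theorem weightForm_add_self (ζ a : ℂ) (r s : ℂ[X]) :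
    (weightForm μ ζ (C a * r + s) (C a * r + s)).re =
      ‖a‖ ^ 2 * (weightForm μ ζ r r).re + 2 * (a * weightForm μ ζ s r).re +
        (weightForm μ ζ s s).re := by
  have h1 : weightForm μ ζ (C a * r + s) (C a * r + s) =
      (‖a‖ ^ 2 : ℝ) * weightForm μ ζ r r + (a * weightForm μ ζ s r +
        conj (a * weightForm μ ζ s r)) + weightForm μ ζ s s := by
    rw [map_mul, conj_weightForm]
    push_cast
    rw [← Complex.conj_mul']
    simp only [weightForm, mul_add, mul_left_comm X (C a), map_add, LinearMap.add_apply,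
      polyForm_C_mul_left, polyForm_C_mul_right]
    ring
  rw [h1, Complex.add_conj, Complex.add_re, Complex.add_re, Complex.re_ofReal_mul,
    Complex.ofReal_re]

/-- With `Re ζ = (ζ + conj ζ) / 2` and multiplication by `z` an isometry, the terms group into
multiples of `(z - 1) R_n`, so the division by `z - 1` disappears. -/
theorem weightForm_paraQuotient (hμ : μ.support.Infinite) (ζ : ℂ) (p : ℂ[X]) (n : ℕ) :
    weightForm μ ζ p (paraQuotient μ n) =
      -(1 / 2) * (conj ζ * polyForm μ p (paraOPUC μ n) -
        ζ * polyForm μ (X * p) (paraOPUC μ n)) := by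
  have hζ : (ζ.re : ℂ) = (ζ + conj ζ) / 2 := Complex.re_eq_add_conj ζ
  rw [paraOPUC_eq hμ, weightForm, hζ, map_sub, map_sub, polyForm_X_mul_X_mul]
  ring

theorem weightForm_paraQuotient_self (hμ : μ.support.Infinite) (ζ : ℂ) (n : ℕ) :
    (weightForm μ ζ (paraQuotient μ n) (paraQuotient μ n)).re =
      normSqOPUC μ n * (ζ * (1 - tau μ n * verblunsky μ n)).re := by
  have h : weightForm μ ζ (paraQuotient μ n) (paraQuotient μ n) =
      ((normSqOPUC μ n * (ζ * (1 - tau μ n * verblunsky μ n)).re : ℝ) : ℂ) := by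
    rw [weightForm_paraQuotient hμ, polyForm_paraOPUC hμ (natDegree_paraQuotient n).le,
      polyForm_X_mul_paraOPUC hμ (natDegree_paraQuotient n).le, coeff_zero_paraQuotient hμ,
      coeff_paraQuotient_self hμ, Complex.ofReal_mul, Complex.re_eq_add_conj, map_mul, map_one]
    linear_combination (1 / 2 * conj ζ * conj (1 - tau μ n * verblunsky μ n) * normSqOPUC μ n) *
      conj_mul_self_of_norm_eq_one (norm_tau hμ n)
  rw [h, Complex.ofReal_re]

theorem norm_weightForm_paraQuotient (hμ : μ.support.Infinite) {ζ : ℂ} (hζ : ‖ζ‖ = 1) {n : ℕ}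
    {p : ℂ[X]} (hp : p.natDegree ≤ n) :
    ‖weightForm μ ζ p (paraQuotient μ (n + 1))‖ =
      1 / 2 * normSqOPUC μ (n + 1) * ‖1 - tau μ (n + 1) * verblunsky μ (n + 1)‖ *
        ‖p.coeff 0‖ := by
  rw [weightForm_paraQuotient hμ, polyForm_paraOPUC hμ (by omega),
    polyForm_X_mul_paraOPUC hμ (by omega), coeff_eq_zero_of_natDegree_lt (n := n + 1) (by omega)]
  simp only [map_zero, zero_mul, mul_zero, sub_zero, norm_mul, norm_neg, Complex.norm_conj, hζ,
    norm_tau hμ, Complex.norm_real, Real.norm_of_nonneg (normSqOPUC_pos hμ (n + 1)).le]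
  norm_num
  ring

theorem norm_weightForm_X_mul_paraQuotient (hμ : μ.support.Infinite) {ζ : ℂ} (hζ : ‖ζ‖ = 1)
    {n : ℕ} {p : ℂ[X]} (hp : p.natDegree ≤ n) :
    ‖weightForm μ ζ (X * p) (paraQuotient μ (n + 1))‖ =
      1 / 2 * normSqOPUC μ (n + 1) * ‖1 - tau μ (n + 1) * verblunsky μ (n + 1)‖ *
        ‖p.coeff n‖ := by
  have hXp : (X * p).natDegree ≤ n + 1 := by
    refine natDegree_mul_le.trans ?_
    rw [natDegree_X]
    omega
  rw [weightForm_paraQuotient hμ, polyForm_paraOPUC hμ hXp,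
    polyForm_X_mul_paraOPUC hμ hXp, coeff_X_mul, mul_coeff_zero, coeff_X_zero]
  simp only [map_zero, zero_mul, mul_zero, neg_zero, zero_sub, norm_mul, norm_neg,
    Complex.norm_conj, hζ, Complex.norm_real,
    Real.norm_of_nonneg (normSqOPUC_pos hμ (n + 1)).le]
  norm_num
  ring

/-- The lowest coefficient for even `n`, the coefficient of degree `n` for odd `n`. -/
noncomputable def alternatingCoeff (n : ℕ) (p : ℂ[X]) : ℂ :=
  if Even n then p.coeff 0 else p.coeff n

theorem quadratic_nonneg_of_sq_le {P R b u v : ℝ} (hP : 0 < P) (hb : b ^ 2 ≤ P * R) :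
    0 ≤ P * u ^ 2 - 2 * (u * (b * v)) + R * v ^ 2 := by
  have h : 0 ≤ P * (P * u ^ 2 - 2 * (u * (b * v)) + R * v ^ 2) := by
    nlinarith [sq_nonneg (P * u - b * v), mul_nonneg (sub_nonneg.2 hb) (sq_nonneg v)]
  exact nonneg_of_mul_nonneg_right h hP

/-- If the squared off-diagonal entries of the tridiagonal matrix of the form are dominated by a
chain sequence times products of the diagonal entries, then the form is positive. -/
theorem le_weightForm_self (hμ : μ.support.Infinite) {ζ : ℂ} (hζ : ‖ζ‖ = 1) {ε : ℝ}
    (hε : |ε| = 1) {A h : ℕ → ℝ}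
    (hA : ∀ n, A n = ε * (normSqOPUC μ n * (ζ * (1 - tau μ n * verblunsky μ n)).re))
    (hApos : ∀ n, 0 < A n) (h0 : 0 ≤ h 0) (hpos : ∀ n, 0 < h (n + 1))
    (hb : ∀ n, (1 / 2 * normSqOPUC μ (n + 1) *
      ‖1 - tau μ (n + 1) * verblunsky μ (n + 1)‖) ^ 2 ≤
        (1 - h n) * h (n + 1) * (A n * A (n + 1))) (n : ℕ) :
    ∀ p : ℂ[X], p.natDegree ≤ n →
      (1 - h n) * A n * ‖alternatingCoeff n p‖ ^ 2 ≤ ε * (weightForm μ ζ p p).re := by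
  have hrr : ∀ n, ε * (weightForm μ ζ (paraQuotient μ n) (paraQuotient μ n)).re = A n := by
    intro n
    rw [weightForm_paraQuotient_self hμ, hA]
  -- One step of the elimination: `y` is the only coefficient of `s` that couples to `R_{n+1}`, and
  -- the fraction `1 - h n` of the diagonal entry kept so far pays for this coupling.
  have step : ∀ (n : ℕ) (a y : ℂ) (s : ℂ[X]),
      (1 - h n) * A n * ‖y‖ ^ 2 ≤ ε * (weightForm μ ζ s s).re →
      ‖weightForm μ ζ s (paraQuotient μ (n + 1))‖ = 1 / 2 * normSqOPUC μ (n + 1) *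
        ‖1 - tau μ (n + 1) * verblunsky μ (n + 1)‖ * ‖y‖ →
      (1 - h (n + 1)) * A (n + 1) * ‖a‖ ^ 2 ≤
        ε * (weightForm μ ζ (C a * paraQuotient μ (n + 1) + s)
          (C a * paraQuotient μ (n + 1) + s)).re := by
    intro n a y s h1 h2
    rw [weightForm_add_self]
    have h3 : |ε * (a * weightForm μ ζ s (paraQuotient μ (n + 1))).re| ≤
        ‖a‖ * (1 / 2 * normSqOPUC μ (n + 1) *
          ‖1 - tau μ (n + 1) * verblunsky μ (n + 1)‖ * ‖y‖) := by
      rw [abs_mul, hε, one_mul, ← h2, ← norm_mul]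
      exact Complex.abs_re_le_norm _
    have h4 := (abs_le.1 h3).1
    -- The new diagonal entry is split: its part `h (n + 1)` absorbs the cross term, and its part `1
    -- - h (n + 1)` is kept for the next step.
    have h5 := quadratic_nonneg_of_sq_le (u := ‖a‖) (v := ‖y‖)
      (mul_pos (hpos n) (hApos (n + 1)))
      ((hb n).trans_eq (by ring : _ = h (n + 1) * A (n + 1) * ((1 - h n) * A n)))
    have h6 := hrr (n + 1)
    have h7 : ε * (‖a‖ ^ 2 *
        (weightForm μ ζ (paraQuotient μ (n + 1)) (paraQuotient μ (n + 1))).re) =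
          ‖a‖ ^ 2 * A (n + 1) := by rw [← h6]; ring
    linarith
  induction n with
  | zero =>
    intro p hp
    have hr : paraQuotient μ 0 = 1 := by
      rw [eq_C_of_natDegree_eq_zero (natDegree_paraQuotient (μ := μ) 0),
        coeff_paraQuotient_self hμ, map_one]
    have hp' : p = C (p.coeff 0) * paraQuotient μ 0 + 0 := by
      rw [hr, mul_one, add_zero]
      exact eq_C_of_natDegree_le_zero hp
    have h1 := weightForm_add_self (μ := μ) ζ (p.coeff 0) (paraQuotient μ 0) 0
    rw [← hp'] at h1
    have h2 : ∀ q, weightForm μ ζ 0 q = 0 := fun q => by simp [weightForm]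
    rw [h1, h2, h2, alternatingCoeff, if_pos Even.zero]
    have := hrr 0
    have h3 := mul_nonneg (mul_nonneg h0 (hApos 0).le) (sq_nonneg ‖p.coeff 0‖)
    simp only [mul_zero, Complex.zero_re, add_zero]
    rw [mul_left_comm, this]
    linarith
  | succ n ih =>
    intro p hp
    -- For even `n` the leading term is removed, leaving a remainder of degree at most `n` that
    -- couples through its constant coefficient. For odd `n` the constant term is removed and a
    -- factor `X` split off, and the coupling is through the coefficient of degree `n`. Each time
    -- this is the coefficient controlled by the induction hypothesis.
    by_cases hn : Even n
    · have hn' : ¬ Even (n + 1) := by rwa [Nat.even_add_one, not_not]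
      rw [alternatingCoeff, if_neg hn']
      set s := p - C (p.coeff (n + 1)) * paraQuotient μ (n + 1) with hs
      have hsdeg : s.natDegree ≤ n := by
        rw [natDegree_le_iff_coeff_eq_zero]
        intro m hm
        rw [hs, coeff_sub, coeff_C_mul]
        rcases (Nat.succ_le_of_lt hm).eq_or_lt with rfl | hm
        · rw [Nat.succ_eq_add_one, coeff_paraQuotient_self hμ, mul_one, sub_self]
        · rw [coeff_eq_zero_of_natDegree_lt (hp.trans_lt hm),
            coeff_eq_zero_of_natDegree_lt (p := paraQuotient μ (n + 1))
              (by rwa [natDegree_paraQuotient]), mul_zero, sub_zero]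
      have h1 := ih s hsdeg
      rw [alternatingCoeff, if_pos hn] at h1
      have h2 := step n (p.coeff (n + 1)) (s.coeff 0) s h1
        (norm_weightForm_paraQuotient hμ hζ hsdeg)
      rwa [hs, add_sub_cancel] at h2
    · have hn' : Even (n + 1) := by rwa [Nat.even_add_one]
      rw [alternatingCoeff, if_pos hn']
      have hτ : tau μ (n + 1) ≠ 0 := norm_ne_zero_iff.1 (by rw [norm_tau hμ]; exact one_ne_zero)
      obtain ⟨s, hs⟩ : X ∣ p - C (p.coeff 0 / tau μ (n + 1)) * paraQuotient μ (n + 1) := by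
        rw [X_dvd_iff, coeff_sub, coeff_C_mul, coeff_zero_paraQuotient hμ, div_mul_cancel₀ _ hτ,
          sub_self]
      have hsdeg : s.natDegree ≤ n := by
        rw [natDegree_le_iff_coeff_eq_zero]
        intro m hm
        rw [← coeff_X_mul, ← hs, coeff_sub, coeff_C_mul,
          coeff_eq_zero_of_natDegree_lt (n := m + 1) (by omega),
          coeff_eq_zero_of_natDegree_lt (n := m + 1) (by rw [natDegree_paraQuotient]; omega),
          mul_zero, sub_zero]
      have h1 := ih s hsdeg
      rw [alternatingCoeff, if_neg hn, ← weightForm_X_mul_X_mul] at h1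
      have h2 := step n (p.coeff 0 / tau μ (n + 1)) (s.coeff n) (X * s) h1
        (norm_weightForm_X_mul_paraQuotient hμ hζ hsdeg)
      rwa [← hs, add_sub_cancel, norm_div, norm_tau hμ, div_one] at h2

end Para

/-! ### From polynomials to null sets -/

theorem const_mul_integral_sub_half_mul {μ : Measure Circle} {f g h : Circle → ℂ}
    (hf : Integrable f μ)
    (hg : Integrable g μ) (hh : Integrable h μ) (a b c : ℂ) :
    a * ∫ z, f z ∂μ - 1 / 2 * (b * ∫ z, g z ∂μ + c * ∫ z, h z ∂μ) =
      ∫ z, (a * f z - 1 / 2 * (b * g z + c * h z)) ∂μ := by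
  have h1 : ∫ z, (b * g z + c * h z) ∂μ = b * ∫ z, g z ∂μ + c * ∫ z, h z ∂μ := by
    rw [← integral_const_mul, ← integral_const_mul]
    exact integral_add (hg.const_mul b) (hh.const_mul c)
  rw [← h1, ← integral_const_mul, ← integral_const_mul]
  exact (integral_sub (hf.const_mul a)
    (((hg.const_mul b).add (hh.const_mul c)).const_mul _)).symm

section Density

variable {μ : Measure Circle} [IsProbabilityMeasure μ]

/-- A polynomial as a continuous function on the circle. -/
def circlePolynomial (p : ℂ[X]) : C(Circle, ℂ) :=
  ⟨fun z => p.eval (z : ℂ), continuous_polynomial_eval_circle p⟩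

theorem circlePolynomial_apply (p : ℂ[X]) (z : Circle) :
    circlePolynomial p z = p.eval (z : ℂ) := rfl

/-- Elements of this star algebra are Laurent polynomials, since `conj z = z⁻¹` on the circle. A
power of `z` clears the negative exponents. -/
theorem exists_pow_mul_eq_circlePolynomial {f : C(Circle, ℂ)}
    (hf : f ∈ StarAlgebra.adjoin ℂ {circlePolynomial X}) :
    ∃ (k : ℕ) (p : ℂ[X]), circlePolynomial X ^ k * f = circlePolynomial p := by
  induction hf using StarAlgebra.adjoin_induction with
  | mem f hf =>
    rw [Set.mem_singleton_iff.1 hf]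
    exact ⟨0, X, by rw [pow_zero, one_mul]⟩
  | algebraMap r =>
    refine ⟨0, C r, ?_⟩
    ext z
    simp [circlePolynomial_apply]
  | add f g _ _ hf hg =>
    obtain ⟨k, p, hp⟩ := hf
    obtain ⟨l, r, hr⟩ := hg
    refine ⟨k + l, X ^ l * p + X ^ k * r, ?_⟩
    ext z
    have hp' := DFunLike.congr_fun hp z
    have hr' := DFunLike.congr_fun hr z
    simp only [ContinuousMap.mul_apply, ContinuousMap.pow_apply, ContinuousMap.add_apply,
      circlePolynomial_apply, eval_X, eval_add, eval_mul, eval_pow] at *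
    rw [← hp', ← hr']
    ring
  | mul f g _ _ hf hg =>
    obtain ⟨k, p, hp⟩ := hf
    obtain ⟨l, r, hr⟩ := hg
    refine ⟨k + l, p * r, ?_⟩
    ext z
    have hp' := DFunLike.congr_fun hp z
    have hr' := DFunLike.congr_fun hr z
    simp only [ContinuousMap.mul_apply, ContinuousMap.pow_apply, circlePolynomial_apply, eval_X,
      eval_mul] at *
    rw [← hp', ← hr']
    ring
  | star f _ hf =>
    obtain ⟨k, p, hp⟩ := hf
    refine ⟨p.natDegree, X ^ k * (p.map (starRingEnd ℂ)).reflect p.natDegree, ?_⟩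
    ext z
    have hp' := DFunLike.congr_fun hp z
    simp only [ContinuousMap.mul_apply, ContinuousMap.pow_apply, circlePolynomial_apply, eval_X,
      eval_mul, eval_pow, ContinuousMap.star_apply] at *
    rw [eval_conj_map_reflect _ p le_rfl, ← hp', map_mul, map_pow]
    have h1 : conj (z : ℂ) ^ k * (z : ℂ) ^ k = 1 := by rw [← mul_pow, conj_coe_mul_coe, one_pow]
    have h2 : star (f z) = conj (f z) := rfl
    rw [h2]
    linear_combination (-((z : ℂ) ^ p.natDegree * conj (f z))) * h1

theorem dense_adjoin_circlePolynomial_X :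
    Dense (StarAlgebra.adjoin ℂ {circlePolynomial X} : Set C(Circle, ℂ)) := by
  have h := ContinuousMap.starSubalgebra_topologicalClosure_eq_top_of_separatesPoints
    (StarAlgebra.adjoin ℂ {circlePolynomial X}) (by
      intro z w hzw
      refine ⟨circlePolynomial X, ⟨circlePolynomial X,
        StarAlgebra.self_mem_adjoin_singleton ℂ _, rfl⟩, ?_⟩
      rw [circlePolynomial_apply, circlePolynomial_apply, eval_X, eval_X]
      exact fun h => hzw (Circle.coe_injective h))
  rw [dense_iff_closure_eq, ← StarSubalgebra.topologicalClosure_coe, h]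
  rfl

theorem continuous_integral_circle (μ : Measure Circle) [IsProbabilityMeasure μ] :
    Continuous fun f : C(Circle, ℂ) => ∫ z, f z ∂μ := by
  let I : C(Circle, ℂ) →ₗ[ℂ] ℂ :=
    { toFun := fun f => ∫ z, f z ∂μ
      map_add' := fun f g => integral_add (integrable_of_continuous_circle f.continuous)
        (integrable_of_continuous_circle g.continuous)
      map_smul' := fun c f => integral_const_mul _ _ }
  refine (I.mkContinuous 1 fun f => ?_).continuous
  have h := norm_integral_le_of_norm_le_const (μ := μ) (ae_of_all μ f.norm_coe_le_norm)
  rw [probReal_univ, mul_one] at h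
  rw [one_mul]
  exact h

/-- The weight `Re ζ - Re (conj ζ z)`. -/
def circleWeight (ζ : ℂ) (z : Circle) : ℝ := ζ.re - (conj ζ * z).re

theorem continuous_circleWeight (ζ : ℂ) : Continuous (circleWeight ζ) := by
  have : Continuous fun z : Circle => (z : ℂ) := continuous_subtype_val
  exact continuous_const.sub (Complex.continuous_re.comp (continuous_const.mul this))

theorem weightForm_self_eq_integral (ζ : ℂ) (p : ℂ[X]) :
    weightForm μ ζ p p = ∫ z : Circle, (circleWeight ζ z : ℂ) *
      (conj (circlePolynomial p z) * circlePolynomial p z) ∂μ := by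
  rw [weightForm, polyForm_apply, polyForm_apply, polyForm_apply,
    const_mul_integral_sub_half_mul (integrable_conj_eval_mul_eval μ p p)
      (integrable_conj_eval_mul_eval μ p (X * p)) (integrable_conj_eval_mul_eval μ (X * p) p)]
  congr 1
  ext z
  rw [circleWeight, Complex.ofReal_sub, Complex.re_eq_add_conj (conj ζ * z), map_mul,
    Complex.conj_conj]
  simp only [circlePolynomial_apply, eval_mul, eval_X, map_mul]
  ring

/-- The factor `z ^ k` is unimodular, so positivity on polynomials gives it on Laurent polynomials.
These are dense, and the integral is continuous in the uniform norm. -/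
theorem integral_circleWeight_nonneg {ζ : ℂ} {ε : ℝ}
    (h : ∀ p, 0 ≤ ε * (weightForm μ ζ p p).re) (f : C(Circle, ℂ)) :
    0 ≤ ε * (∫ z : Circle, (circleWeight ζ z : ℂ) * (conj (f z) * f z) ∂μ).re := by
  let W : C(Circle, ℂ) :=
    ⟨fun z => (circleWeight ζ z : ℂ), Complex.continuous_ofReal.comp (continuous_circleWeight ζ)⟩
  have hc : Continuous fun f : C(Circle, ℂ) =>
      ε * (∫ z : Circle, (W * (star f * f)) z ∂μ).re :=
    continuous_const.mul (Complex.continuous_re.comp ((continuous_integral_circle μ).comp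
      (continuous_const.mul (continuous_star.mul continuous_id))))
  have hcl : IsClosed {f : C(Circle, ℂ) | 0 ≤ ε * (∫ z : Circle, (W * (star f * f)) z ∂μ).re} :=
    isClosed_le continuous_const hc
  have hsub : (StarAlgebra.adjoin ℂ {circlePolynomial X} : Set C(Circle, ℂ)) ⊆
      {f : C(Circle, ℂ) | 0 ≤ ε * (∫ z : Circle, (W * (star f * f)) z ∂μ).re} := by
    intro f hf
    obtain ⟨k, p, hp⟩ := exists_pow_mul_eq_circlePolynomial hf
    have h1 := h p
    rw [weightForm_self_eq_integral, ← hp] at h1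
    refine h1.trans_eq (congrArg (fun w : ℂ => ε * w.re) (integral_congr_ae
      (ae_of_all _ fun z => ?_)))
    have h2 : conj (z : ℂ) ^ k * (z : ℂ) ^ k = 1 := by rw [← mul_pow, conj_coe_mul_coe, one_pow]
    change _ = (circleWeight ζ z : ℂ) * (conj (f z) * f z)
    simp only [ContinuousMap.mul_apply, ContinuousMap.pow_apply, circlePolynomial_apply, eval_X,
      map_mul, map_pow]
    linear_combination ((circleWeight ζ z : ℂ) * conj (f z) * f z) * h2
  have := hcl.closure_subset_iff.2 hsub (dense_adjoin_circlePolynomial_X f)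
  exact this

theorem measure_circleWeight_neg_eq_zero {ζ : ℂ} {ε : ℝ}
    (h : ∀ p, 0 ≤ ε * (weightForm μ ζ p p).re) : μ {z | ε * circleWeight ζ z < 0} = 0 := by
  -- The test function is the negative part of the signed weight: the weighted integrand becomes
  -- `-g³`, which forces `g = 0` almost everywhere.
  set g : Circle → ℝ := fun z => max (-(ε * circleWeight ζ z)) 0 with hg
  have hgc : Continuous g :=
    ((continuous_const.mul (continuous_circleWeight ζ)).neg).max continuous_const
  have h1 := integral_circleWeight_nonneg h ⟨fun z => (g z : ℂ), Complex.continuous_ofReal.comp hgc⟩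
  have h2 : (∫ z : Circle, (circleWeight ζ z : ℂ) * (conj (g z : ℂ) * (g z : ℂ)) ∂μ) =
      ((∫ z : Circle, circleWeight ζ z * (g z * g z) ∂μ : ℝ) : ℂ) := by
    refine Eq.trans ?_ integral_complex_ofReal
    congr 1
    ext z
    rw [Complex.conj_ofReal]
    push_cast
    rfl
  have h3 : 0 ≤ ε * ∫ z : Circle, circleWeight ζ z * (g z * g z) ∂μ := by
    have := h1.trans_eq (congrArg (fun w : ℂ => ε * w.re) h2)
    rwa [Complex.ofReal_re] at this
  have h4 : ∀ z, ε * (circleWeight ζ z * (g z * g z)) = -(g z ^ 3) := by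
    intro z
    rcases le_total (-(ε * circleWeight ζ z)) 0 with h | h
    · have : g z = 0 := max_eq_right h
      rw [this]; ring
    · have : g z = -(ε * circleWeight ζ z) := max_eq_left h
      rw [this]; ring
  rw [← integral_const_mul] at h3
  simp only [h4] at h3
  rw [integral_neg] at h3
  have hnn : ∀ z, 0 ≤ g z ^ 3 := fun z => pow_nonneg (le_max_right _ _) 3
  have h5 : ∫ z, g z ^ 3 ∂μ = 0 :=
    le_antisymm (by linarith) (integral_nonneg hnn)
  rw [integral_eq_zero_iff_of_nonneg hnn
    ((hgc.pow 3).integrable_of_hasCompactSupport (HasCompactSupport.of_compactSpace _))] at h5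
  refine measure_mono_null (fun z hz => ?_) h5
  have hz' : ε * circleWeight ζ z < 0 := hz
  have : 0 < g z := lt_max_of_lt_left (by linarith)
  exact (pow_pos this 3).ne'

end Density

/-! ### Positivity from the chain sequence condition -/

section Positivity

variable {μ : Measure Circle}

/-- To be read with `N = N_n`, `α2 = |α_n|²`, `r = 1 - Re β_n`, `r' = 1 - Re β_{n+1}` and `v = |1 -
β_{n+1}|`. The first two factors on the right are then `1 - g_{n+1}` and `g_{n+2}`, so their product
is `d_{n+2}`. -/
theorem sq_offDiagonal_eq {N α2 r r' v : ℝ} (hr : r ≠ 0) (hr' : r' ≠ 0) :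
    (1 / 2 * ((1 - α2) * N) * v) ^ 2 =
      (1 - 1 / 2 * ((2 * r - 1 + α2) / r)) * (1 / 2 * (v ^ 2 / r')) *
        ((N * r) * ((1 - α2) * N * r')) := by
  field_simp
  ring

theorem measure_circleWeight_eq_zero_of_chain {c d q : ℕ → ℝ} (hq : IsScalingSequence d q)
    (hμ : HasCDParametrization μ c d) {ζ : ℂ} (hζ : ‖ζ‖ = 1) {ε : ℝ} (hε : |ε| = 1)
    (hX : ∀ n, 1 ≤ n → 0 < ε * (ζ.re - c n * ζ.im))
    (hqX : ∀ n, 1 ≤ n → q (n + 1) ≤ (ζ.re - c n * ζ.im) * (ζ.re - c (n + 1) * ζ.im)) :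
    μ {z | ε * circleWeight ζ z < 0} = 0 := by
  obtain ⟨⟨_, hsupp⟩, hc, hd⟩ := hμ
  obtain ⟨hq01, h, h0, h1, h2, h3⟩ := hq
  set β : ℕ → ℂ := fun n => tau μ n * verblunsky μ n with hβ
  have hβ1 : ∀ n, ‖β n‖ < 1 := norm_tau_mul_verblunsky_lt_one hsupp
  have hr : ∀ n, 0 < 1 - (β n).re := fun n =>
    sub_pos.2 ((Complex.re_le_norm _).trans_lt (hβ1 n))
  have hc' : ∀ n, c (n + 1) = -(β n).im / (1 - (β n).re) := fun n => hc (n + 1) (by omega)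
  have hdiag : ∀ n, (ζ * (1 - β n)).re = (1 - (β n).re) * (ζ.re - c (n + 1) * ζ.im) := by
    intro n
    have := (hr n).ne'
    rw [hc']
    simp only [Complex.mul_re, Complex.sub_re, Complex.one_re, Complex.sub_im, Complex.one_im]
    field_simp
    ring
  have hsq : ε * ε = 1 := by rw [← abs_mul_abs_self, hε, one_mul]
  refine measure_circleWeight_neg_eq_zero fun p => ?_
  have hpos : ∀ n, 0 < ε * (normSqOPUC μ n * (ζ * (1 - β n)).re) := by
    intro n
    rw [hdiag]
    have := mul_pos (mul_pos (normSqOPUC_pos hsupp n) (hr n)) (hX (n + 1) (by omega))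
    linarith
  have hoff : ∀ n, (1 / 2 * normSqOPUC μ (n + 1) * ‖1 - β (n + 1)‖) ^ 2 ≤
      (1 - h (n + 1)) * h (n + 1 + 1) * (ε * (normSqOPUC μ n * (ζ * (1 - β n)).re) *
        (ε * (normSqOPUC μ (n + 1) * (ζ * (1 - β (n + 1))).re))) := by
    intro n
    have hqpos := (hq01 (n + 1) (by omega)).1
    have hα : ‖verblunsky μ n‖ ^ 2 = ‖β n‖ ^ 2 := by
      rw [hβ]
      simp only [norm_mul, norm_tau hsupp, one_mul]
    have hnorm : ‖1 - β n‖ ^ 2 = 2 * (1 - (β n).re) - 1 + ‖β n‖ ^ 2 := by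
      rw [← Complex.normSq_eq_norm_sq, ← Complex.normSq_eq_norm_sq, Complex.normSq_apply,
        Complex.normSq_apply]
      simp only [Complex.sub_re, Complex.one_re, Complex.sub_im, Complex.one_im]
      ring
    have hd' : d (n + 1 + 1) = (1 - 1 / 2 * (‖1 - β n‖ ^ 2 / (1 - (β n).re))) *
        (1 / 2 * (‖1 - β (n + 1)‖ ^ 2 / (1 - (β (n + 1)).re))) := hd (n + 1) (by omega)
    have hE := sq_offDiagonal_eq (N := normSqOPUC μ n) (α2 := ‖β n‖ ^ 2) (v := ‖1 - β (n + 1)‖)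
      (hr n).ne' (hr (n + 1)).ne'
    rw [← hnorm, ← hd', ← hα, ← normSqOPUC_succ hsupp] at hE
    have h3' : d (n + 1 + 1) / q (n + 1 + 1) = (1 - h (n + 1)) * h (n + 1 + 1) :=
      h3 (n + 1) (by omega)
    rw [← h3', hdiag, hdiag]
    have hq' := hqX (n + 1) (by omega)
    set E := (1 / 2 * normSqOPUC μ (n + 1) * ‖1 - β (n + 1)‖) ^ 2
    have hE0 : 0 ≤ E := sq_nonneg _
    set Y := (ζ.re - c (n + 1) * ζ.im) * (ζ.re - c (n + 1 + 1) * ζ.im) with hY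
    have hfin : d (n + 1 + 1) / q (n + 1 + 1) *
        (ε * (normSqOPUC μ n * ((1 - (β n).re) * (ζ.re - c (n + 1) * ζ.im))) *
          (ε * (normSqOPUC μ (n + 1) *
            ((1 - (β (n + 1)).re) * (ζ.re - c (n + 1 + 1) * ζ.im))))) =
        E * Y / q (n + 1 + 1) := by
      rw [hE, hY]
      field_simp
      linear_combination (d (n + 1 + 1) * normSqOPUC μ n * normSqOPUC μ (n + 1) *
        (1 - (β n).re) * (1 - (β (n + 1)).re) * (ζ.re - c (n + 1) * ζ.im) *
          (ζ.re - c (n + 1 + 1) * ζ.im)) * hsq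
    rw [hfin, le_div_iff₀ hqpos]
    exact mul_le_mul_of_nonneg_left hq' hE0
  -- The parameter sequence of `d / q` starts at index `1` and the basis at index `0`, hence the
  -- shift. Only the initial parameter may be zero.
  have hmain := le_weightForm_self hsupp hζ hε (A := fun n => ε * (normSqOPUC μ n *
    (ζ * (1 - β n)).re)) (h := fun n => h (n + 1)) (fun _ => rfl) hpos h0
    (fun n => (h2 (n + 2) (by omega)).1) hoff p.natDegree p le_rfl
  refine le_trans ?_ hmain
  have hh : 0 ≤ 1 - h (p.natDegree + 1) := by
    rcases Nat.eq_zero_or_pos p.natDegree with h' | h'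
    · rw [h']; exact (sub_pos.2 h1).le
    · exact (sub_pos.2 (h2 _ (by omega)).2).le
  exact mul_nonneg (mul_nonneg hh (hpos _).le) (sq_nonneg _)

end Positivity

/-! ### The bounds `u^{(±)}` -/

theorem toCos_coe (u : ℝ) : toCos (u : EReal) = u / √(1 + u ^ 2) := by
  rw [toCos, if_neg (EReal.coe_ne_top u), if_neg (EReal.coe_ne_bot u), EReal.toReal_coe]

theorem toCos_top : toCos ⊤ = 1 := by
  rw [toCos, if_pos rfl]

theorem toCos_coe_strictMono : StrictMono fun u : ℝ => toCos (u : EReal) := by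
  intro u v huv
  have := Real.sin_arctan_strictMono huv
  simpa only [toCos_coe, Real.sin_arctan] using this

theorem toCos_coe_lt_one (u : ℝ) : toCos (u : EReal) < 1 := by
  refine (toCos_coe_strictMono (lt_add_one u)).trans_le ?_
  simp only [toCos_coe, ← Real.sin_arctan]
  exact Real.sin_le_one _

theorem toCos_neg (u : EReal) : toCos (-u) = -toCos u := by
  induction u using EReal.rec with
  | bot => simp [toCos]
  | coe u => rw [← EReal.coe_neg, toCos_coe, toCos_coe, neg_sq, neg_div]
  | top => simp [toCos]

theorem toCos_le_one (u : EReal) : toCos u ≤ 1 := by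
  induction u using EReal.rec with
  | bot => simp [toCos]
  | coe u => exact (toCos_coe_lt_one u).le
  | top => exact toCos_top.le

theorem uMinus_eq_neg_uPlus (a b q : ℝ) : uMinus a b q = -uPlus (-a) (-b) q := by
  rw [uMinus, uPlus]
  split_ifs with h1 h2 h3 h3
  · simp
  · exact absurd (by linarith) h3
  · exact absurd (by linarith) h2
  · rw [← EReal.coe_neg, ← neg_add, div_neg, neg_neg, neg_mul_neg]
  · rw [← EReal.coe_neg, neg_mul_neg, ← neg_add, neg_sq, ← neg_div]
    congr 2
    ring

/-- The inequality `q (1 + v²) ≤ (v - a) (v - b)` says that the defining polynomial is nonnegative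
at `v`. At `a` and `b` this polynomial is negative, with values `-q (1 + a²)` and `-q (1 + b²)`, so
both points lie below a finite `u^{(+)}`. -/
theorem uPlus_spec (a b : ℝ) {q : ℝ} (hq : 0 < q) (hq1 : q ≤ 1) :
    uPlus a b q = ⊤ ∨ ∃ u : ℝ, uPlus a b q = u ∧
      ∀ v, u ≤ v → a < v ∧ b < v ∧ q * (1 + v ^ 2) ≤ (v - a) * (v - b) := by
  rw [uPlus]
  split_ifs with h1 h2
  · exact Or.inl rfl
  · refine Or.inr ⟨_, rfl, fun v hv => ?_⟩
    push Not at h2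
    have ha : a < (a * b - 1) / (a + b) := by
      rw [lt_div_iff_of_neg h2]
      nlinarith [sq_nonneg a]
    have hb : b < (a * b - 1) / (a + b) := by
      rw [lt_div_iff_of_neg h2]
      nlinarith [sq_nonneg b]
    rw [div_le_iff_of_neg h2] at hv
    refine ⟨ha.trans_le ?_, hb.trans_le ?_, ?_⟩
    · rwa [div_le_iff_of_neg h2]
    · rwa [div_le_iff_of_neg h2]
    · rw [h1]
      linarith
  · refine Or.inr ⟨_, rfl, fun v hv => ?_⟩
    have hq' : 0 < 1 - q := sub_pos.2 (lt_of_le_of_ne hq1 h1)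
    set D := (a + b) ^ 2 - 4 * (1 - q) * (a * b - q) with hD
    -- The difference of the two sides is `4 (1 - q) q (1 + a²)`.
    have hDa : (2 * (1 - q) * a - (a + b)) ^ 2 < D := by
      have : 0 < 4 * (1 - q) * (q * (1 + a ^ 2)) := by positivity
      rw [hD]
      linarith
    have hDb : (2 * (1 - q) * b - (a + b)) ^ 2 < D := by
      have : 0 < 4 * (1 - q) * (q * (1 + b ^ 2)) := by positivity
      rw [hD]
      linarith
    have hv' : √D ≤ 2 * (1 - q) * v - (a + b) := by
      rw [div_le_iff₀ (by positivity)] at hv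
      linarith
    have ha := (Real.lt_sqrt_of_sq_lt hDa).trans_le hv'
    have hb := (Real.lt_sqrt_of_sq_lt hDb).trans_le hv'
    refine ⟨?_, ?_, ?_⟩
    · exact lt_of_mul_lt_mul_left (by linarith) (by positivity : 0 ≤ 2 * (1 - q))
    · exact lt_of_mul_lt_mul_left (by linarith) (by positivity : 0 ≤ 2 * (1 - q))
    · have hsq : D ≤ (2 * (1 - q) * v - (a + b)) ^ 2 := (Real.sqrt_le_left
        ((Real.sqrt_nonneg _).trans hv')).1 hv'
      have : 0 ≤ 4 * (1 - q) * ((v - a) * (v - b) - q * (1 + v ^ 2)) := by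
        rw [hD] at hsq
        linarith
      have := nonneg_of_mul_nonneg_right this (by positivity)
      linarith

theorem toCos_lt_toCos_uPlus (a b : ℝ) {q : ℝ} (hq : 0 < q) (hq1 : q ≤ 1) :
    toCos (a : EReal) < toCos (uPlus a b q) := by
  rcases uPlus_spec a b hq hq1 with h | ⟨u, h, hu⟩
  · rw [h, toCos_top]
    exact toCos_coe_lt_one a
  · rw [h]
    exact toCos_coe_strictMono (hu u le_rfl).1

/-- The finite number `a` separates the two roots strictly, also when one of them is infinite. -/
theorem toCos_uMinus_lt_toCos_uPlus (a b : ℝ) {q : ℝ} (hq : 0 < q) (hq1 : q ≤ 1) :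
    toCos (uMinus a b q) < toCos (uPlus a b q) := by
  refine lt_trans ?_ (toCos_lt_toCos_uPlus a b hq hq1)
  have h := toCos_lt_toCos_uPlus (-a) (-b) hq hq1
  rw [EReal.coe_neg, toCos_neg] at h
  rw [uMinus_eq_neg_uPlus, toCos_neg]
  linarith

/-- With `x = cos (θ / 2)` and `s = sin (θ / 2)`, the condition `u^{(+)} ≤ cot (θ / 2)`. -/
theorem le_mul_of_toCos_uPlus_le {a b q x s : ℝ} (hq : 0 < q) (hq1 : q ≤ 1) (hs : 0 < s)
    (hxs : x ^ 2 + s ^ 2 = 1) (h : toCos (uPlus a b q) ≤ x) :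
    0 < x - a * s ∧ 0 < x - b * s ∧ q ≤ (x - a * s) * (x - b * s) := by
  have hx : toCos ((x / s : ℝ) : EReal) = x := by
    have h1 : 1 + (x / s) ^ 2 = (1 / s) ^ 2 := by
      field_simp
      linarith
    rw [toCos_coe, h1, Real.sqrt_sq (by positivity)]
    field_simp
  rcases uPlus_spec a b hq hq1 with hu | ⟨u, hu, hv⟩
  · rw [hu, toCos_top] at h
    nlinarith
  · rw [hu, ← hx] at h
    obtain ⟨ha, hb, hab⟩ := hv (x / s) (toCos_coe_strictMono.le_iff_le.1 h)
    rw [lt_div_iff₀ hs] at ha hb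
    refine ⟨by linarith, by linarith, ?_⟩
    have h1 := mul_le_mul_of_nonneg_right hab (sq_nonneg s)
    have h2 : q * (1 + (x / s) ^ 2) * s ^ 2 = q := by
      field_simp
      linarith
    have h3 : (x / s - a) * (x / s - b) * s ^ 2 = (x - a * s) * (x - b * s) := by
      field_simp
    rwa [h2, h3] at h1

/-! ### Monotone convergence of `A_N` and `B_N`. -/

theorem exists_tendsto_sup' {f : ℕ → ℝ} (hf : ∀ n, f n ≤ 1) :
    ∃ B ≤ 1, (∀ n, 2 ≤ n → f n ≤ B) ∧ Tendsto (fun N => if h : 2 ≤ N then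
      (Finset.Icc 2 N).sup' (Finset.nonempty_Icc.mpr h) f else 0) atTop (𝓝 B) := by
  set F : ℕ → ℝ := fun N => if h : 2 ≤ N then
      (Finset.Icc 2 N).sup' (Finset.nonempty_Icc.mpr h) f else 0 with hF
  have hFN : ∀ N, F (N + 2) =
      (Finset.Icc 2 (N + 2)).sup' (Finset.nonempty_Icc.mpr (by omega)) f := by
    intro N
    rw [hF]
    exact dif_pos (by omega)
  -- The shift by two avoids the default value `0` at `N < 2`, which could destroy monotonicity.
  have hmono : Monotone fun N => F (N + 2) := by
    intro M N hMN
    simp only [hFN]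
    exact Finset.sup'_mono f (Finset.Icc_subset_Icc_right (by omega)) _
  have hle : ∀ N, F (N + 2) ≤ 1 := by
    intro N
    rw [hFN]
    exact Finset.sup'_le _ _ fun n _ => hf n
  have hbdd : BddAbove (Set.range fun N => F (N + 2)) := ⟨1, by rintro _ ⟨N, rfl⟩; exact hle N⟩
  refine ⟨⨆ N, F (N + 2), ciSup_le hle, fun n hn => ?_, ?_⟩
  · obtain ⟨k, rfl⟩ : ∃ k, n = k + 2 := ⟨n - 2, by omega⟩
    refine le_trans ?_ (le_ciSup hbdd k)
    simp only [hFN]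
    exact Finset.le_sup' f (Finset.mem_Icc.2 ⟨by omega, le_rfl⟩)
  · exact (tendsto_add_atTop_iff_nat 2).1 (tendsto_atTop_ciSup hmono hbdd)

theorem exists_tendsto_upperBound (c q : ℕ → ℝ) :
    ∃ B ≤ 1, (∀ n, 2 ≤ n → toCos (uPlus (c (n - 1)) (c n) (q n)) ≤ B) ∧
      Tendsto (upperBound c q) atTop (𝓝 B) :=
  exists_tendsto_sup' fun _ => toCos_le_one _

theorem lowerBound_eq_neg_upperBound (c q : ℕ → ℝ) (N : ℕ) :
    lowerBound c q N = -upperBound (fun n => -c n) q N := by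
  have h : ∀ n, toCos (uMinus (c (n - 1)) (c n) (q n)) =
      -toCos (uPlus (-c (n - 1)) (-c n) (q n)) := fun n => by
    rw [uMinus_eq_neg_uPlus, toCos_neg]
  rw [lowerBound, upperBound]
  split_ifs with hN
  · simp only [h]
    refine le_antisymm ?_ ?_
    · rw [le_neg]
      exact Finset.sup'_le _ _ fun n hn => le_neg.1 (Finset.inf'_le
        (fun n => -toCos (uPlus (-c (n - 1)) (-c n) (q n))) hn)
    · exact Finset.le_inf' _ _ fun n hn => neg_le_neg (Finset.le_sup'
        (fun n => toCos (uPlus (-c (n - 1)) (-c n) (q n))) hn)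
  · exact neg_zero.symm

/-! ### Arcs of the circle -/

theorem circleWeight_exp (θ t : ℝ) :
    circleWeight (Circle.exp (θ / 2)) (Circle.exp t) =
      2 * Real.sin (t / 2) * Real.sin ((t - θ) / 2) := by
  have h1 : ((Circle.exp (θ / 2) : ℂ)).re = Real.cos (θ / 2) := by
    rw [Circle.coe_exp, Complex.exp_ofReal_mul_I_re]
  have h2 : (starRingEnd ℂ) (Circle.exp (θ / 2) : ℂ) * (Circle.exp t : ℂ) =
      (Circle.exp (t - θ / 2) : ℂ) := by
    rw [← Circle.coe_inv_eq_conj, ← Circle.exp_neg, ← Circle.coe_mul, ← Circle.exp_add]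
    congr 2
    ring
  rw [circleWeight, h1, h2, Circle.coe_exp, Complex.exp_ofReal_mul_I_re, Real.cos_sub_cos]
  rw [show (θ / 2 + (t - θ / 2)) / 2 = t / 2 by ring,
    show (θ / 2 - (t - θ / 2)) / 2 = -((t - θ) / 2) by ring, Real.sin_neg]
  ring

theorem exists_exp_eq_of_ne_one {z : Circle} (hz : z ≠ 1) :
    ∃ t, 0 < t ∧ t < 2 * Real.pi ∧ Circle.exp t = z := by
  have h1 := Complex.neg_pi_lt_arg (z : ℂ)
  have h2 := Complex.arg_le_pi (z : ℂ)
  have h3 : Circle.exp (Complex.arg z) = z := Circle.exp_arg z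
  have h4 : Complex.arg (z : ℂ) ≠ 0 := fun h => hz (by rw [← h3, h, Circle.exp_zero])
  rcases lt_or_gt_of_ne h4 with h | h
  · refine ⟨Complex.arg z + 2 * Real.pi, by linarith [Real.pi_pos], by linarith, ?_⟩
    rw [Circle.exp_add_two_pi, h3]
  · exact ⟨Complex.arg z, h, by linarith [Real.pi_pos], h3⟩

section Arcs

variable {μ : Measure Circle} {c d q : ℕ → ℝ}

theorem measure_exp_Ioo_left_eq_zero (hq : IsScalingSequence d q)
    (hμ : HasCDParametrization μ c d) {θ : ℝ} (hθ1 : θ < 2 * Real.pi)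
    (hθ : ∀ n, 2 ≤ n → toCos (uPlus (c (n - 1)) (c n) (q n)) ≤ Real.cos (θ / 2)) :
    μ (Circle.exp '' Set.Ioo 0 θ) = 0 := by
  rcases le_or_gt θ 0 with h0 | h0
  · rw [Set.Ioo_eq_empty (not_lt.2 h0), Set.image_empty, measure_empty]
  have hs : 0 < Real.sin (θ / 2) := Real.sin_pos_of_pos_of_lt_pi (by linarith) (by linarith)
  have hre : ((Circle.exp (θ / 2) : ℂ)).re = Real.cos (θ / 2) := by
    rw [Circle.coe_exp, Complex.exp_ofReal_mul_I_re]
  have him : ((Circle.exp (θ / 2) : ℂ)).im = Real.sin (θ / 2) := by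
    rw [Circle.coe_exp, Complex.exp_ofReal_mul_I_im]
  have key := fun n (hn : 1 ≤ n) => le_mul_of_toCos_uPlus_le (hq.1 n hn).1 (hq.1 n hn).2 hs
    (Real.cos_sq_add_sin_sq _) (hθ (n + 1) (by omega))
  refine measure_mono_null ?_ (measure_circleWeight_eq_zero_of_chain hq hμ
    (Circle.norm_coe (Circle.exp (θ / 2))) (ε := 1) abs_one ?_ ?_)
  · rintro _ ⟨t, ⟨ht0, ht⟩, rfl⟩
    change 1 * circleWeight _ _ < 0
    rw [one_mul, circleWeight_exp]
    have h1 : 0 < Real.sin (t / 2) := Real.sin_pos_of_pos_of_lt_pi (by linarith) (by linarith)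
    have h2 : Real.sin ((t - θ) / 2) < 0 :=
      Real.sin_neg_of_neg_of_neg_pi_lt (by linarith) (by linarith)
    exact mul_neg_of_pos_of_neg (by linarith) h2
  · intro n hn
    rw [hre, him, one_mul]
    exact (key n hn).1
  · intro n hn
    rw [hre, him]
    exact (key n hn).2.2

/-- Mirror image of `measure_exp_Ioo_left_eq_zero`: `-cos (θ/2)` and `-c` replace `cos (θ/2)` and
`c`. All diagonal factors `x - c_n s` are now negative, their products are unchanged, and `ε = -1`
restores positivity. -/
theorem measure_exp_Ioo_right_eq_zero (hq : IsScalingSequence d q)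
    (hμ : HasCDParametrization μ c d) {θ : ℝ} (hθ0 : 0 < θ)
    (hθ : ∀ n, 2 ≤ n → toCos (uPlus (-c (n - 1)) (-c n) (q n)) ≤ -Real.cos (θ / 2)) :
    μ (Circle.exp '' Set.Ioo θ (2 * Real.pi)) = 0 := by
  rcases le_or_gt (2 * Real.pi) θ with h0 | h0
  · rw [Set.Ioo_eq_empty (not_lt.2 h0), Set.image_empty, measure_empty]
  have hs : 0 < Real.sin (θ / 2) := Real.sin_pos_of_pos_of_lt_pi (by linarith) (by linarith)
  have hre : ((Circle.exp (θ / 2) : ℂ)).re = Real.cos (θ / 2) := by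
    rw [Circle.coe_exp, Complex.exp_ofReal_mul_I_re]
  have him : ((Circle.exp (θ / 2) : ℂ)).im = Real.sin (θ / 2) := by
    rw [Circle.coe_exp, Complex.exp_ofReal_mul_I_im]
  have key := fun n (hn : 1 ≤ n) => le_mul_of_toCos_uPlus_le (hq.1 n hn).1 (hq.1 n hn).2 hs
    (by rw [neg_sq]; exact Real.cos_sq_add_sin_sq _) (hθ (n + 1) (by omega))
  refine measure_mono_null ?_ (measure_circleWeight_eq_zero_of_chain hq hμ
    (Circle.norm_coe (Circle.exp (θ / 2))) (ε := -1) (by simp) ?_ ?_)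
  · rintro _ ⟨t, ⟨ht0, ht⟩, rfl⟩
    change -1 * circleWeight _ _ < 0
    rw [circleWeight_exp]
    have h1 : 0 < Real.sin (t / 2) := Real.sin_pos_of_pos_of_lt_pi (by linarith) (by linarith)
    have h2 : 0 < Real.sin ((t - θ) / 2) :=
      Real.sin_pos_of_pos_of_lt_pi (by linarith) (by linarith)
    have := mul_pos h1 h2
    linarith
  · intro n hn
    rw [hre, him]
    have := (key n hn).1
    rw [Nat.add_sub_cancel] at this
    linarith
  · intro n hn
    rw [hre, him]
    have := (key n hn).2.2
    rw [Nat.add_sub_cancel] at this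
    linarith

/-- The two open arcs omit the point `1`, about which the weight gives no information. At `t = 0`
the family has no mass there. -/
theorem support_massFamily_zero_subset {θ₁ θ₂ : ℝ}
    (h1 : μ (Circle.exp '' Set.Ioo 0 θ₁) = 0)
    (h2 : μ (Circle.exp '' Set.Ioo θ₂ (2 * Real.pi)) = 0) :
    (massFamily μ 0).support ⊆ closedArc θ₁ θ₂ := by
  have hcl : IsClosed (closedArc θ₁ θ₂) :=
    (isCompact_Icc.image Circle.exp.continuous).isClosed
  refine Measure.support_subset_of_isClosed hcl ?_
  rw [mem_ae_iff, massFamily, ENNReal.ofReal_zero, zero_smul, add_zero, Measure.smul_apply,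
    Measure.restrict_apply hcl.measurableSet.compl, smul_eq_mul]
  refine mul_eq_zero_of_right _ (measure_mono_null ?_ (measure_union_null h1 h2))
  rintro z ⟨hz, hz1⟩
  obtain ⟨t, ht0, ht, rfl⟩ := exists_exp_eq_of_ne_one hz1
  by_contra hne
  rw [Set.mem_union, not_or] at hne
  refine hz ⟨t, ⟨?_, ?_⟩, rfl⟩
  · by_contra h
    exact hne.1 ⟨t, ⟨ht0, not_le.1 h⟩, rfl⟩
  · by_contra h
    exact hne.2 ⟨t, ⟨not_le.1 h, ht⟩, rfl⟩

end Arcs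

end UnitCircle

/-! ### The limit angles and the support. -/

theorem mainTheorem5 (c d q : ℕ → ℝ)
    (hd : UnitCircle.IsNonSPChainSequence d)
    (hq : UnitCircle.IsScalingSequence d q)
    (μ : Measure Circle) (hμ : UnitCircle.HasCDParametrization μ c d) :
    ∃ θ₁ θ₂ : ℝ, 0 ≤ θ₁ ∧ θ₁ < θ₂ ∧ θ₂ ≤ 2 * Real.pi ∧
      Tendsto (fun N => 2 * Real.arccos (UnitCircle.upperBound c q N)) atTop (𝓝 θ₁) ∧
      Tendsto (fun N => 2 * Real.arccos (UnitCircle.lowerBound c q N)) atTop (𝓝 θ₂) ∧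
      (UnitCircle.massFamily μ 0).support ⊆ UnitCircle.closedArc θ₁ θ₂ := by
  obtain ⟨B, hB1, hB, hBlim⟩ := UnitCircle.exists_tendsto_upperBound c q
  obtain ⟨A, hA1, hA, hAlim⟩ := UnitCircle.exists_tendsto_upperBound (fun n => -c n) q
  -- The term `n = 2` alone separates the limits: `-A` lies below its value for `u^{(-)}` and `B`
  -- above its value for `u^{(+)}`.
  have hAB : -A < B := by
    have h1 := hB 2 le_rfl
    have h2 := hA 2 le_rfl
    have h3 := UnitCircle.toCos_uMinus_lt_toCos_uPlus (c (2 - 1)) (c 2) (hq.1 1 le_rfl).1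
      (hq.1 1 le_rfl).2
    rw [UnitCircle.uMinus_eq_neg_uPlus, UnitCircle.toCos_neg] at h3
    linarith
  have hcosB : Real.cos (2 * Real.arccos B / 2) = B := by
    rw [mul_div_cancel_left₀ _ two_ne_zero, Real.cos_arccos (by linarith) hB1]
  have hcosA : Real.cos (2 * Real.arccos (-A) / 2) = -A := by
    rw [mul_div_cancel_left₀ _ two_ne_zero, Real.cos_arccos (by linarith) (by linarith)]
  have hlt : Real.arccos B < Real.arccos (-A) := Real.strictAntiOn_arccos
    ⟨by linarith, by linarith⟩ ⟨by linarith, hB1⟩ hAB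
  have h0 := Real.arccos_nonneg B
  have hpi := Real.arccos_le_pi (-A)
  refine ⟨2 * Real.arccos B, 2 * Real.arccos (-A), by linarith, by linarith, by linarith,
    hBlim.arccos.const_mul 2, ?_, UnitCircle.support_massFamily_zero_subset
      (UnitCircle.measure_exp_Ioo_left_eq_zero hq hμ (by linarith) (by rwa [hcosB]))
      (UnitCircle.measure_exp_Ioo_right_eq_zero hq hμ (by linarith)
        (by rw [hcosA, neg_neg]; exact hA))⟩
  simp only [UnitCircle.lowerBound_eq_neg_upperBound]
  exact hAlim.neg.arccos.const_mul 2
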